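/- Conventions. For a finite set $S$ let $V_S=\mathbb{F}_2^{S}$ with standard basis $(e_s)_{s\in S}$, and $[m]=\{1,\dots,m\}$. Let $n\ge 1$ and $k_1,\dots,k_n\ge 1$ be integers, put $N=k_1+\dots+k_n$, divide $[N]$ into $n$ consecutive blocks of sizes $k_1,\dots,k_n$, and let $\pi:V_{[N]}\to V_{[n]}$ be the linear map that sums the coordinates in each block. An \emph{$N$-expansion group} is a triple $(G,\phi,(g_1,\dots,g_N))$ of a group $G$, a homomorphism $\phi:G\to V_{[N]}$ and elements $g_i\in G$ with $\phi(g_i)=e_i$ and $g_i^2=1$ for all $i$, such that $\ker\phi=[G,G]$ and $\ker\phi$ is an $\mathbb{F}_2$-vector space (that is, abelian with all squares trivial). It is a \emph{$[(k_1,\dots,k_n)]$-expansion group} if moreover $\phi^{-1}(\ker\pi)$ is an $\mathbb{F}_2$-vector space. A homomorphism of expansion groups is a group homomorphism sending the $i$-th distinguished generator to the $i$-th distinguished generator for every $i$. Construction. For a finite set $T$ let $\mathbb{F}_2^T$ act on its group algebra $\mathbb{F}_2[\mathbb{F}_2^T]$ by translation and form $\mathbb{F}_2[\mathbb{F}_2^T]\rtimes\mathbb{F}_2^T$.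 For $i\in[N]$ put $G_i=\mathbb{F}_2[V_{[N]-\{i\}}]\rtimes V_{[N]-\{i\}}$, with elements $g_{i,j}=(0,e_j)$ for $j\ne i$ and $g_{i,i}=(1,0)$, where $1$ is the unit of the group algebra, and with the homomorphism $G_i\to V_{[N]}$, $g_{i,j}\mapsto e_j$, given by the projection to $V_{[N]-\{i\}}$ and, in the $i$-th coordinate, by the augmentation of the group algebra component. Let $\mathcal{G}$ be the subgroup of $\prod_{i\in[N]}G_i$ generated by the elements $g_j=(g_{i,j})_{i\in[N]}$, $j\in[N]$; the projections $G_i\to V_{[N]}$ induce a homomorphism $\mathcal{G}\to V_{[N]}$ with $g_j\mapsto e_j$. For $x\in[N]$ in the $i$-th block let $$\phi_x:\mathcal{G}\to\mathbb{F}_2[\mathbb{F}_2^{[n]-\{i\}}]\rtimes\mathbb{F}_2^{[n]-\{i\}}$$ be the unique homomorphism with $\phi_x(g_y)=(0,e_h)$ for $y$ in the $h$-th block with $h\neq i$, $\phi_x(g_x)=(1,0)$, and $\phi_x(g_y)$ trivial for the other $y$ in the $i$-th block. Put $\widetilde{\mathcal{G}}=\mathcal{G}/\bigcap_{x\in[N]}\ker\phi_x$,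 with the images of $g_1,\dots,g_N$ as distinguished generators and the induced homomorphism $\widetilde{\mathcal{G}}\to V_{[N]}$. Theorem. The group $\widetilde{\mathcal{G}}$ with this homomorphism and these generators is a $[(k_1,\dots,k_n)]$-expansion group. For every $[(k_1,\dots,k_n)]$-expansion group $(G,\phi,(g_1,\dots,g_N))$ there is a homomorphism of expansion groups $\widetilde{\mathcal{G}}\to G$; it is unique and surjective. In particular $G$ is finite, with $$\#G\le 2^{(k_1+\dots+k_n)\cdot 2^{n-1}-2^n+n+1},$$ and equality holds if and only if the homomorphism $\widetilde{\mathcal{G}}\to G$ is an isomorphism. -/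

import Mathlib

/-! ### The vector space `V_S` over `𝔽₂`, written multiplicatively -/

/-- The `𝔽₂`-vector space `V_S` with basis indexed by the (finite) set `S`, as a multiplicative
group. -/
abbrev VSpace (S : Type*) : Type _ := Multiplicative (S → ZMod 2)

/-- The basis vector `e_s` of `V_S`. -/
def basisVec {S : Type*} [DecidableEq S] (s : S) : VSpace S :=
  Multiplicative.ofAdd (Pi.single s 1)

/-- A subgroup "is a vector space over `𝔽₂`": it is abelian and all its elements square to `1`. -/
def IsF2VectorSpace {G : Type*} [Group G] (H : Subgroup G) : Prop :=
  (∀ a ∈ H, ∀ b ∈ H, a * b = b * a) ∧ ∀ a ∈ H, a ^ 2 = 1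

/-! ### Expansion groups -/

/-- `(G, φ, (g_s)_{s ∈ S})` is an `S`-expansion group; for `#S = m` this is an `m`-expansion
group. -/
structure IsExpansionGroup {S : Type*} [DecidableEq S] {G : Type*} [Group G]
    (φ : G →* VSpace S) (g : S → G) : Prop where
  map_gen : ∀ s, φ (g s) = basisVec s
  ker_vectorSpace : IsF2VectorSpace φ.ker
  commutator_eq : commutator G = φ.ker
  gen_sq : ∀ s, g s ^ 2 = 1

/-- The index set `[k_1 + ⋯ + k_n]`, divided into its `n` blocks: `⟨i, a⟩` is the `a`-th element
of the `i`-th block. -/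
abbrev BlockIndex {n : ℕ} (k : Fin n → ℕ) : Type := Σ i : Fin n, Fin (k i)

/-- The map `π_{(k_1, …, k_n)} : V_{[k_1 + ⋯ + k_n]} → V_{[n]}` that sums every block of
coordinates. -/
def blockSum {n : ℕ} (k : Fin n → ℕ) : VSpace (BlockIndex k) →* VSpace (Fin n) :=
  AddMonoidHom.toMultiplicative
    { toFun := fun v i => ∑ a : Fin (k i), v ⟨i, a⟩
      map_zero' := by ext i; simp
      map_add' := fun v w => by ext i; simp [Finset.sum_add_distrib] }

/-- `(G, φ, (g_x))` is a `[(k_1, …, k_n)]`-expansion group: a `(k_1 + ⋯ + k_n)`-expansion group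
such that `φ⁻¹(ker π)` is a vector space over `𝔽₂`. -/
structure IsBlockExpansionGroup {n : ℕ} (k : Fin n → ℕ) {G : Type*} [Group G]
    (φ : G →* VSpace (BlockIndex k)) (g : BlockIndex k → G) : Prop where
  isExpansionGroup : IsExpansionGroup φ g
  ker_block_vectorSpace : IsF2VectorSpace ((blockSum k).ker.comap φ)

/-- A homomorphism of expansion groups is a group homomorphism that maps the distinguished
generators to the distinguished generators. -/
def IsExpansionHom {S G G' : Type*} [Group G] [Group G'] (g : S → G) (g' : S → G')
    (f : G →* G') : Prop :=
  ∀ s, f (g s) = g' s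

/-! ### The groups `𝔽₂[𝔽₂^T] ⋊ 𝔽₂^T` -/

/-- The action of `𝔽₂^T` on (the additive group of) its group algebra `𝔽₂[𝔽₂^T]` by
translation. -/
noncomputable def translation (T : Type*) :
    VSpace T →* MulAut (Multiplicative (MonoidAlgebra (ZMod 2) (VSpace T))) where
  toFun v :=
    { toFun := fun a => .ofAdd (MonoidAlgebra.of (ZMod 2) (VSpace T) v * a.toAdd)
      invFun := fun a => .ofAdd (MonoidAlgebra.of (ZMod 2) (VSpace T) v⁻¹ * a.toAdd)
      left_inv := fun a => by
        change Multiplicative.ofAdd (_ * (_ * a.toAdd)) = a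
        rw [← mul_assoc, ← map_mul, inv_mul_cancel, map_one, one_mul, ofAdd_toAdd]
      right_inv := fun a => by
        change Multiplicative.ofAdd (_ * (_ * a.toAdd)) = a
        rw [← mul_assoc, ← map_mul, mul_inv_cancel, map_one, one_mul, ofAdd_toAdd]
      map_mul' := fun a b => by rw [toAdd_mul, mul_add, ofAdd_add] }
  map_one' := by
    ext a
    simp only [map_one, one_mul, ofAdd_toAdd, MulEquiv.coe_mk, Equiv.coe_fn_mk, MulAut.one_apply]
  map_mul' v w := by
    ext a
    simp only [map_mul, mul_assoc, MulEquiv.coe_mk, Equiv.coe_fn_mk, MulAut.mul_apply, toAdd_ofAdd]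

/-- The group `𝔽₂[𝔽₂^T] ⋊ 𝔽₂^T`. -/
abbrev GroupAlgSemidirect (T : Type*) : Type _ :=
  Multiplicative (MonoidAlgebra (ZMod 2) (VSpace T)) ⋊[translation T] VSpace T

/-- The element `(1 · [0], 0)` of `𝔽₂[𝔽₂^T] ⋊ 𝔽₂^T`. -/
noncomputable def pointerElt (T : Type*) : GroupAlgSemidirect T :=
  SemidirectProduct.inl (.ofAdd 1)

/-- The element `(0, e_t)` of `𝔽₂[𝔽₂^T] ⋊ 𝔽₂^T`. -/
noncomputable def transElt {T : Type*} [DecidableEq T] (t : T) : GroupAlgSemidirect T :=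
  SemidirectProduct.inr (basisVec t)

/-- The homomorphism `𝔽₂[𝔽₂^T] ⋊ 𝔽₂^T → 𝔽₂[𝔽₂^T'] ⋊ 𝔽₂^T'` induced by a linear map
`p : 𝔽₂^T → 𝔽₂^T'`. -/
noncomputable def GroupAlgSemidirect.map {T T' : Type*} (p : VSpace T →* VSpace T') :
    GroupAlgSemidirect T →* GroupAlgSemidirect T' :=
  SemidirectProduct.map
    (AddMonoidHom.toMultiplicative (MonoidAlgebra.mapDomainRingHom (ZMod 2) p).toAddMonoidHom) p
    (fun v => by
      ext a
      simp [translation, MonoidAlgebra.of, map_mul])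

/-- The augmentation `𝔽₂[𝔽₂^T] → 𝔽₂`. -/
noncomputable def augmentation (T : Type*) : MonoidAlgebra (ZMod 2) (VSpace T) →+* ZMod 2 :=
  (MonoidAlgebra.lift (ZMod 2) (ZMod 2) (VSpace T) 1 :
    MonoidAlgebra (ZMod 2) (VSpace T) →ₐ[ZMod 2] ZMod 2).toRingHom

/-- The augmentation is compatible with the ring homomorphisms induced by linear maps. -/
theorem augmentation_mapDomain {T T' : Type*} (p : VSpace T →* VSpace T')
    (a : MonoidAlgebra (ZMod 2) (VSpace T)) :
    augmentation T' (MonoidAlgebra.mapDomainRingHom (ZMod 2) p a) = augmentation T a := by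
  have h : (augmentation T').comp (MonoidAlgebra.mapDomainRingHom (ZMod 2) p) =
      augmentation T := by
    ext <;> simp [augmentation]
  exact DFunLike.congr_fun h a

/-- The monomial `t_B = ∏_{j ∈ B} (1 + e_j)` of `𝔽₂[𝔽₂^T]`. -/
noncomputable def groupAlgMonomial {T : Type*} [DecidableEq T] (B : Finset T) :
    MonoidAlgebra (ZMod 2) (VSpace T) :=
  ∏ j ∈ B, (1 + MonoidAlgebra.of (ZMod 2) (VSpace T) (basisVec j))

/-- The action of the basis vectors on the monomials: `e_j • t_B = t_B + t_{B ∪ {j}}` for `j ∉ B`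
and `e_j • t_B = t_B` for `j ∈ B`. -/
theorem translation_monomial {T : Type*} [DecidableEq T] (j : T) (B : Finset T) :
    translation T (basisVec j) (.ofAdd (groupAlgMonomial B)) =
      .ofAdd (if j ∈ B then groupAlgMonomial B
        else groupAlgMonomial B + groupAlgMonomial (insert j B)) := by
  change Multiplicative.ofAdd (MonoidAlgebra.of (ZMod 2) (VSpace T) (basisVec j) *
    groupAlgMonomial B) = _
  have h2 : ∀ a : MonoidAlgebra (ZMod 2) (VSpace T), a + a = 0 := fun a => by
    rw [← two_smul (ZMod 2) a]; exact (congrArg (· • a) (by decide)).trans (zero_smul _ a)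
  congr 1
  split_ifs with h
  · have hs : MonoidAlgebra.of (ZMod 2) (VSpace T) (basisVec j) *
        MonoidAlgebra.of (ZMod 2) (VSpace T) (basisVec j) = 1 := by
      rw [← map_mul]
      have : (basisVec j * basisVec j : VSpace T) = 1 := by
        unfold basisVec
        rw [← ofAdd_add, ← ofAdd_zero]; congr 1; ext l; exact CharTwo.add_self_eq_zero _
      rw [this, map_one]
    unfold groupAlgMonomial
    rw [← Finset.mul_prod_erase B _ h, ← mul_assoc, mul_add, hs, mul_one, add_comm]
  · unfold groupAlgMonomial
    rw [Finset.prod_insert h, add_mul, one_mul, ← add_assoc, h2, zero_add]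

/-! ### The expansion groups `G_s(S)` and their product `𝒢(S)` -/

section Governing

variable {S : Type*} [DecidableEq S]

/-- The group `G_s(S) = 𝔽₂[V_{S - {s}}] ⋊ V_{S - {s}}`. In terms of the basis of monomials
`e_A = ∏_{j ∈ A - {s}} (1 + e_j)`, `s ∈ A ⊆ S`, of the group algebra, the action is
`e_j • e_A = e_A + e_{A ∪ {j}}` for `j ∉ A` and `e_j • e_A = e_A` for `j ∈ A`. -/
abbrev SingleGroup (s : S) : Type _ := GroupAlgSemidirect {j : S // j ≠ s}

/-- The distinguished generators of `G_s(S)`: `g_{s,j} = (0, e_j)` for `j ≠ s`, and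
`g_{s,s} = (e_{{s}}, 0)`, where `e_{{s}}` is the unit of the group algebra. -/
noncomputable def singleGen (s j : S) : SingleGroup s :=
  if h : j = s then pointerElt _ else transElt ⟨j, h⟩

/-- The projection `φ_s : G_s(S) → V_S`: the coordinates other than `s` come from the quotient
`V_{S - {s}}`, the coordinate `s` is the augmentation of the group algebra component. -/
noncomputable def singleProj (s : S) : SingleGroup s →* VSpace S where
  toFun x := .ofAdd fun j =>
    if h : j = s then augmentation _ x.left.toAdd else x.right.toAdd ⟨j, h⟩
  map_one' := by
    rw [← ofAdd_zero]; congr 1; ext j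
    by_cases h : j = s <;> simp [h]
  map_mul' x y := by
    rw [← ofAdd_add]; congr 1; ext j
    by_cases h : j = s <;> simp [h, translation, augmentation, map_mul]

/-- `φ_s(g_{s,j}) = e_j`. -/
theorem singleProj_singleGen (s j : S) : singleProj s (singleGen s j) = basisVec j := by
  unfold singleProj basisVec
  simp only [MonoidHom.coe_mk, OneHom.coe_mk]
  congr 1; ext l
  by_cases hj : j = s
  · subst hj
    by_cases hl : l = j
    · subst hl; simp [singleGen, pointerElt]
    · simp [singleGen, pointerElt, hl]
  · by_cases hl : l = s
    · subst hl; simp [singleGen, hj, transElt, eq_comm]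
    · simp [singleGen, hj, hl, transElt, basisVec, Pi.single_apply]

/-- The group `𝒢(S)`, the product of the expansion groups `G_s(S)`: the subgroup of the direct
product of the groups `G_s(S)` generated by the elements `(g_{s,j})_{s ∈ S}`, `j ∈ S`. -/
noncomputable def governingSubgroup (S : Type*) [DecidableEq S] : Subgroup ((s : S) → SingleGroup s) :=
  Subgroup.closure (Set.range fun j : S => fun s : S => singleGen s j)

/-- The distinguished generator of `𝒢(S)` with index `j`. -/
noncomputable def governingGen (j : S) : governingSubgroup S :=
  ⟨fun s => singleGen s j, Subgroup.subset_closure ⟨j, rfl⟩⟩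

/-- The projection `𝒢(S) → V_S`. It is the common value of the maps `φ_s` on the components
(see `governingProj_eq`); its coordinate `s` is read off from the component `s`. -/
noncomputable def governingProj (S : Type*) [DecidableEq S] : governingSubgroup S →* VSpace S where
  toFun x := .ofAdd fun s => (singleProj s (x.1 s)).toAdd s
  map_one' := by rw [← ofAdd_zero]; congr 1; ext s; simp
  map_mul' x y := by rw [← ofAdd_add]; congr 1; ext s; simp

/-- The projection of `𝒢(S)` maps its `j`-th generator to `e_j`. -/
theorem governingProj_governingGen (j : S) : governingProj S (governingGen j) = basisVec j := by
  simp [governingProj, governingGen, singleProj_singleGen, basisVec]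

/-- Homomorphisms on `𝒢(S)` that agree on the distinguished generators are equal. -/
theorem governing_hom_ext {M : Type*} [Group M] {f f' : governingSubgroup S →* M}
    (h : ∀ j, f (governingGen j) = f' (governingGen j)) : f = f' := by
  ext ⟨x, hx⟩
  unfold governingSubgroup at hx
  induction hx using Subgroup.closure_induction with
  | mem x hx => obtain ⟨j, rfl⟩ := hx; exact h j
  | one => exact (map_one f).trans (map_one f').symm
  | mul x y hx hy ihx ihy =>
    have e : (⟨x * y, mul_mem hx hy⟩ : governingSubgroup S) = ⟨x, hx⟩ * ⟨y, hy⟩ := rfl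
    rw [e, map_mul, map_mul, ihx, ihy]
  | inv x hx ih =>
    have e : (⟨x⁻¹, inv_mem hx⟩ : governingSubgroup S) = ⟨x, hx⟩⁻¹ := rfl
    rw [e, map_inv, map_inv, ih]

/-- The projection of `𝒢(S)` is `φ_s` on the component `s`, for every `s`. -/
theorem governingProj_eq (s : S) (x : governingSubgroup S) :
    governingProj S x = singleProj s (x.1 s) := by
  have h : governingProj S = (singleProj s).comp
      ((Pi.evalMonoidHom (fun s : S => SingleGroup s) s).comp (governingSubgroup S).subtype) :=
    governing_hom_ext fun j => by
      rw [governingProj_governingGen]; exact (singleProj_singleGen s j).symm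
  exact DFunLike.congr_fun h x

end Governing

/-! ### The governing group `𝒢̃([(k_1, …, k_n)])` -/

section GoverningBlock

variable {n : ℕ} (k : Fin n → ℕ)

/-- For `x` in the `i`-th block: the map `𝔽₂^{[k_1 + ⋯ + k_n] - {x}} → 𝔽₂^{[n] - {i}}` that sums
the coordinates over each of the blocks other than the `i`-th. -/
def blockSumAway (x : BlockIndex k) :
    VSpace {y : BlockIndex k // y ≠ x} →* VSpace {h : Fin n // h ≠ x.1} :=
  AddMonoidHom.toMultiplicative
    { toFun := fun v h => ∑ a : Fin (k h.1), v ⟨⟨h.1, a⟩, fun e => h.2 (congrArg Sigma.fst e)⟩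
      map_zero' := by ext i; simp
      map_add' := fun v w => by ext i; simp [Finset.sum_add_distrib] }

/-- For `x` in the `i`-th block: the homomorphism
`φ_x : 𝒢([k_1 + ⋯ + k_n]) → 𝔽₂[𝔽₂^{[n] - {i}}] ⋊ 𝔽₂^{[n] - {i}}`. It is determined by its values
on the generators, given in `blockHom_governingGen`. -/
noncomputable def blockHom (x : BlockIndex k) :
    governingSubgroup (BlockIndex k) →* GroupAlgSemidirect {h : Fin n // h ≠ x.1} :=
  (GroupAlgSemidirect.map (blockSumAway k x)).comp
    ((Pi.evalMonoidHom (fun s : BlockIndex k => SingleGroup s) x).comp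
      (governingSubgroup (BlockIndex k)).subtype)

/-- `φ_x` sends `g_y` to `(0, e_h)` if `y` lies in the `h`-th block and `h ≠ i`; on the `i`-th
block it sends `g_x` to `(1 · [0], 0)` and the other generators to the identity. -/
theorem blockHom_governingGen (x y : BlockIndex k) :
    blockHom k x (governingGen y) =
      if h : y.1 = x.1 then (if y = x then pointerElt _ else 1) else transElt ⟨y.1, h⟩ := by
  change GroupAlgSemidirect.map (blockSumAway k x) (singleGen x y) = _
  by_cases hyx : y = x
  · subst hyx
    simp [singleGen, pointerElt, GroupAlgSemidirect.map]
  · have key : GroupAlgSemidirect.map (blockSumAway k x) (singleGen x y) =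
        SemidirectProduct.inr (blockSumAway k x (basisVec ⟨y, hyx⟩)) := by
      simp [singleGen, hyx, transElt, GroupAlgSemidirect.map]
    rw [key]
    obtain ⟨h, b⟩ := y
    by_cases hh : h = x.1
    · rw [dif_pos hh, if_neg hyx, ← map_one SemidirectProduct.inr]
      congr 1
      unfold blockSumAway basisVec
      rw [AddMonoidHom.toMultiplicative_apply_apply, ← ofAdd_zero]
      congr 1; ext l
      change (∑ a : Fin (k l.1), _ : ZMod 2) = 0
      refine Finset.sum_eq_zero fun a _ => ?_
      refine Pi.single_eq_of_ne (fun e => l.2 ?_) _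
      exact (congrArg (fun z => z.1.1) e).trans hh
    · rw [dif_neg hh]
      unfold transElt
      congr 1
      unfold blockSumAway basisVec
      rw [AddMonoidHom.toMultiplicative_apply_apply]
      congr 1; ext l
      obtain ⟨l, hl⟩ := l
      by_cases hlh : l = h
      · subst hlh
        simp [Pi.single_apply, Subtype.ext_iff]
      · simp [Subtype.ext_iff, hlh]

/-- The intersection of the kernels of the maps `φ_x`. -/
noncomputable def governingKernel : Subgroup (governingSubgroup (BlockIndex k)) :=
  ⨅ x : BlockIndex k, (blockHom k x).ker

instance governingKernel_normal : (governingKernel k).Normal :=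
  Subgroup.normal_iInf_normal fun _ => inferInstance

/-- The group `𝒢̃([(k_1, …, k_n)])`: the quotient of `𝒢([k_1 + ⋯ + k_n])` by the intersection of
the kernels of the maps `φ_x`. -/
abbrev GoverningBlockGroup : Type :=
  governingSubgroup (BlockIndex k) ⧸ governingKernel k

/-- The distinguished generators of `𝒢̃([(k_1, …, k_n)])`: the classes of those of
`𝒢([k_1 + ⋯ + k_n])`. -/
noncomputable def governingBlockGen (y : BlockIndex k) : GoverningBlockGroup k :=
  QuotientGroup.mk (governingGen y)

/-- The projection of `𝒢([k_1 + ⋯ + k_n])` is trivial on the intersection of the kernels of the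
maps `φ_x`. -/
theorem governingKernel_le : governingKernel k ≤ (governingProj (BlockIndex k)).ker := by
  intro z hz
  rw [MonoidHom.mem_ker]
  unfold governingProj
  simp only [MonoidHom.coe_mk, OneHom.coe_mk]
  rw [← ofAdd_zero]; congr 1; ext x
  have hx : blockHom k x z = 1 := (Subgroup.mem_iInf.1 hz x)
  have hl : MonoidAlgebra.mapDomainRingHom (ZMod 2) (blockSumAway k x) (z.1 x).left.toAdd = 0 :=
    congrArg (fun w => (SemidirectProduct.left w).toAdd) hx
  have := augmentation_mapDomain (blockSumAway k x) (z.1 x).left.toAdd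
  rw [hl, map_zero] at this
  simp [singleProj, ← this]

/-- The projection `𝒢̃([(k_1, …, k_n)]) → V_{[k_1 + ⋯ + k_n]}` induced by the projection of
`𝒢([k_1 + ⋯ + k_n])`. -/
noncomputable def governingBlockProj : GoverningBlockGroup k →* VSpace (BlockIndex k) :=
  QuotientGroup.lift _ (governingProj (BlockIndex k)) (governingKernel_le k)

end GoverningBlock

/-! ### Elementary facts on `V_T` and its group algebra -/

/-! Let ψ : G → V_{[n]} be φ followed by the block sums. Its kernel M is an 𝔽₂-vector space, and
conjugation makes it a module over 𝔽₂[V_{[n]}] (`exists_isKernelModule`). Write t_A for the product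
of the 1 + e_j with j ∈ A, and h_i for the first generator of block i. Since G is generated by the
g_x (`closure_gen_eq_top`, a Nakayama argument), M is generated as a module by d_x = g_x h_i, for x
in block i, and c_{il} = [h_i, h_l] (`span_eq_top`). These satisfy (1 + e_i) d_x = 0, (1 + e_i)
c_{il} = (1 + e_l) c_{il} = 0 and a Jacobi identity. Straightening with these relations leaves the
spanning family of all t_A d_x with x not first in its block i and i ∉ A, and all t_{A - {m}} c_{im}
with i ∉ A and m = max A > i. It has N·2^{n-1} - 2^n + 1 members (`card_isAdmissible`).

Homomorphisms with the values of the φ_x on the generators restrict to semilinear maps from M to the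
group algebra, and their coefficients yield functionals dual to the spanning family (`exists_dual`).
Where such homomorphisms exist, the family is therefore a basis and they jointly detect M
(`card_ker_and_eq_one_of_pointer`). This gives the order of 𝒢̃. It also shows that every block
expansion group with a homomorphism to 𝒢̃ is isomorphic to it, because the φ_x can be pulled back.

For universality, let P be the subgroup of G × 𝒢̃ generated by the pairs of generators. It is again
a block expansion group, so P → 𝒢̃ is an isomorphism, and its inverse followed by P → G is the
required map. Uniqueness and surjectivity follow from generation. -/

theorem vspace_mul_self {T : Type*} (v : VSpace T) : v * v = 1 := by
  apply Multiplicative.toAdd.injective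
  ext l
  exact CharTwo.add_self_eq_zero _

theorem vspace_closure_basisVec (T : Type*) [Fintype T] [DecidableEq T] :
    Subgroup.closure (Set.range (basisVec (S := T))) = ⊤ := by
  rw [eq_top_iff]
  intro v _
  have hv : v = ∏ i, Multiplicative.ofAdd (Pi.single i (v.toAdd i) : T → ZMod 2) := by
    apply Multiplicative.toAdd.injective
    rw [toAdd_prod]
    exact (Finset.univ_sum_single v.toAdd).symm
  rw [hv]
  refine Subgroup.prod_mem _ fun i _ => ?_
  generalize v.toAdd i = a
  have ha : a = 0 ∨ a = 1 := by revert a; decide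
  rcases ha with rfl | rfl
  · rw [Pi.single_zero]; exact one_mem _
  · exact Subgroup.subset_closure ⟨i, rfl⟩

/-- A family of pairwise commuting involutions is the image of the basis of `V_T`. -/
theorem exists_vspace_hom {T Q : Type*} [Fintype T] [DecidableEq T] [Group Q] (q : T → Q)
    (hc : ∀ i j, Commute (q i) (q j)) (hq : ∀ i, q i ^ 2 = 1) :
    ∃ f : VSpace T →* Q, ∀ i, f (basisVec i) = q i := by
  let z : T → Multiplicative (ZMod 2) →* Q := fun i =>
    AddMonoidHom.toMultiplicativeLeft (ZMod.lift 2 ⟨zmultiplesHom (Additive Q) (.ofMul (q i)), by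
      simp only [zmultiplesHom_apply]
      rw [← ofMul_zpow, ← ofMul_one]
      congr 1
      exact_mod_cast hq i⟩)
  have hz : ∀ i, z i (.ofAdd 1) = q i := fun i => by
    have := ZMod.lift_coe 2 (⟨zmultiplesHom (Additive Q) (.ofMul (q i)), by
      simp only [zmultiplesHom_apply]
      rw [← ofMul_zpow, ← ofMul_one]
      congr 1
      exact_mod_cast hq i⟩ : { f : ℤ →+ Additive Q // f (2 : ℕ) = 0 }) 1
    simp only [Int.cast_one, zmultiplesHom_apply, one_smul] at this
    exact congrArg Additive.toMul this
  have hcz : Pairwise fun i j => ∀ x y, Commute (z i x) (z j y) := by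
    intro i j _ x y
    have hx : ∀ x : Multiplicative (ZMod 2), x = 1 ∨ x = .ofAdd 1 := by decide
    rcases hx x with rfl | rfl <;> rcases hx y with rfl | rfl <;> simp [hz, hc]
  let w : VSpace T →* (T → Multiplicative (ZMod 2)) :=
    { toFun := fun v i => .ofAdd (v.toAdd i)
      map_one' := rfl
      map_mul' := fun _ _ => rfl }
  refine ⟨(MonoidHom.noncommPiCoprod z hcz).comp w, fun i => ?_⟩
  have : w (basisVec i) = Pi.mulSingle i (.ofAdd 1) := by
    funext j
    rcases eq_or_ne j i with rfl | h
    · simp [w, basisVec]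
    · simp [w, basisVec, h]
  rw [MonoidHom.comp_apply, this, MonoidHom.noncommPiCoprod_mulSingle, hz]

/-- A group generated by involutions lying over the basis of `V_T` has commutator subgroup the
kernel of the projection to `V_T`. -/
theorem commutator_eq_ker_of_closure_eq_top {T Γ : Type*} [Fintype T] [DecidableEq T] [Group Γ]
    {φ : Γ →* VSpace T} {g : T → Γ} (hφ : ∀ s, φ (g s) = basisVec s) (hg : ∀ s, g s ^ 2 = 1)
    (htop : Subgroup.closure (Set.range g) = ⊤) : commutator Γ = φ.ker := by
  apply le_antisymm (Abelianization.commutator_subset_ker φ)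
  -- The generators become commuting involutions in the abelianization, so the map to the
  -- abelianization factors through `φ`; hence `φ.ker` lies in its kernel.
  obtain ⟨f, hf⟩ := exists_vspace_hom (fun s => Abelianization.of (g s))
    (fun i j => Commute.all _ _) (fun i => by rw [← map_pow, hg, map_one])
  have hcomp : f.comp φ = Abelianization.of := by
    refine MonoidHom.eq_of_eqOn_dense htop ?_
    rintro _ ⟨s, rfl⟩
    rw [MonoidHom.comp_apply, hφ, hf]
  intro p hp
  rw [← Abelianization.ker_of Γ, MonoidHom.mem_ker, ← hcomp, MonoidHom.comp_apply,
    MonoidHom.mem_ker.1 hp, map_one]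

/-- An additive subgroup stable under the group elements is stable under the group algebra. -/
theorem smul_mem_of_forall_of_smul_mem {T M : Type*} [AddCommGroup M]
    [Module (MonoidAlgebra (ZMod 2) (VSpace T)) M] (W : AddSubgroup M) (m : M)
    (h : ∀ v, MonoidAlgebra.of (ZMod 2) (VSpace T) v • m ∈ W)
    (r : MonoidAlgebra (ZMod 2) (VSpace T)) : r • m ∈ W := by
  induction r using MonoidAlgebra.induction_on with
  | of v => exact h v
  | add a b ha hb => rw [add_smul]; exact add_mem ha hb
  | smul c a ha =>
    have hc : c = 0 ∨ c = 1 := by revert c; decide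
    rcases hc with rfl | rfl
    · rw [zero_smul, zero_smul]; exact zero_mem _
    · rwa [one_smul]

theorem groupAlg_add_self {T : Type*} (a : MonoidAlgebra (ZMod 2) (VSpace T)) : a + a = 0 := by
  rw [← two_smul (ZMod 2) a]
  exact (congrArg (· • a) (by decide)).trans (zero_smul _ a)

theorem add_self_eq_zero_of_groupAlg {T M : Type*} [AddCommGroup M]
    [Module (MonoidAlgebra (ZMod 2) (VSpace T)) M] (m : M) : m + m = 0 := by
  have : (1 + 1 : MonoidAlgebra (ZMod 2) (VSpace T)) • m = 0 := by
    rw [groupAlg_add_self, zero_smul]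
  rwa [add_smul, one_smul] at this

/-- The element `1 + e_j` of the group algebra. -/
noncomputable abbrev onePlus {T : Type*} [DecidableEq T] (j : T) :
    MonoidAlgebra (ZMod 2) (VSpace T) :=
  1 + MonoidAlgebra.of (ZMod 2) (VSpace T) (basisVec j)

theorem groupAlgMonomial_insert {T : Type*} [DecidableEq T] {j : T} {A : Finset T} (h : j ∉ A) :
    groupAlgMonomial (insert j A) = groupAlgMonomial A * onePlus j := by
  unfold groupAlgMonomial
  rw [Finset.prod_insert h, mul_comm]

theorem groupAlgMonomial_eq_erase_mul {T : Type*} [DecidableEq T] {j : T} {A : Finset T}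
    (h : j ∈ A) : groupAlgMonomial A = groupAlgMonomial (A.erase j) * onePlus j := by
  rw [← groupAlgMonomial_insert (Finset.notMem_erase j A), Finset.insert_erase h]

/-- The monomials expand into group elements. -/
theorem groupAlgMonomial_eq_sum {T : Type*} [DecidableEq T] (A : Finset T) :
    groupAlgMonomial A =
      ∑ C ∈ A.powerset, MonoidAlgebra.of (ZMod 2) (VSpace T) (∏ j ∈ C, basisVec j) := by
  unfold groupAlgMonomial
  rw [Finset.prod_one_add]
  simp only [map_prod]

/-- An additive subgroup containing all multiples of `m` by monomials contains all multiples of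
`m`. -/
theorem smul_mem_of_forall_monomial {T M : Type*} [Fintype T] [DecidableEq T] [AddCommGroup M]
    [Module (MonoidAlgebra (ZMod 2) (VSpace T)) M] (W : AddSubgroup M) (m : M)
    (h : ∀ A : Finset T, groupAlgMonomial A • m ∈ W)
    (r : MonoidAlgebra (ZMod 2) (VSpace T)) : r • m ∈ W := by
  -- `W` need not be stable under translations, but the span of the monomial multiples is, so the
  -- argument runs in `W'`.
  let W' : AddSubgroup M := AddSubgroup.closure (Set.range fun A : Finset T =>
    groupAlgMonomial A • m)
  have hW' : W' ≤ W := by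
    rw [AddSubgroup.closure_le]
    rintro _ ⟨A, rfl⟩
    exact h A
  have hstep : ∀ j : T, ∀ a ∈ W', MonoidAlgebra.of (ZMod 2) (VSpace T) (basisVec j) • a ∈ W' := by
    intro j a ha
    induction ha using AddSubgroup.closure_induction with
    | mem a ha =>
      obtain ⟨A, rfl⟩ := ha
      have := congrArg Multiplicative.toAdd (translation_monomial j A)
      change MonoidAlgebra.of (ZMod 2) (VSpace T) (basisVec j) * groupAlgMonomial A = _ at this
      simp only [← mul_smul]
      rw [this]
      split_ifs
      · exact AddSubgroup.subset_closure ⟨A, rfl⟩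
      · change (groupAlgMonomial A + groupAlgMonomial (insert j A)) • m ∈ W'
        rw [add_smul]
        exact add_mem (AddSubgroup.subset_closure ⟨A, rfl⟩) (AddSubgroup.subset_closure ⟨_, rfl⟩)
    | zero => rw [smul_zero]; exact zero_mem _
    | add a b _ _ ha hb => rw [smul_add]; exact add_mem ha hb
    | neg a _ ha => rw [smul_neg]; exact neg_mem ha
  have hm : m ∈ W' := by
    have : groupAlgMonomial (∅ : Finset T) • m = m := by simp [groupAlgMonomial]
    rw [← this]
    exact AddSubgroup.subset_closure ⟨∅, rfl⟩
  apply hW'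
  refine smul_mem_of_forall_of_smul_mem W' m (fun v => ?_) r
  have hv : v ∈ Subgroup.closure (Set.range (basisVec (S := T))) := by
    rw [vspace_closure_basisVec]; trivial
  suffices ∀ a ∈ W', MonoidAlgebra.of (ZMod 2) (VSpace T) v • a ∈ W' from this m hm
  induction hv using Subgroup.closure_induction with
  | mem v hv => obtain ⟨j, rfl⟩ := hv; exact hstep j
  | one => intro a ha; rwa [map_one, one_smul]
  | mul v w _ _ hv hw => intro a ha; rw [map_mul, mul_smul]; exact hv _ (hw _ ha)
  | inv v _ hv =>
    intro a ha
    rw [inv_eq_of_mul_eq_one_left (vspace_mul_self v)]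
    exact hv a ha

/-! ### The functionals dual to the monomials -/

/-- The functional on the group algebra sending `v` to `∏ j ∈ A, v_j`. -/
noncomputable def monomialDual {T : Type*} (A : Finset T) :
    MonoidAlgebra (ZMod 2) (VSpace T) →+ ZMod 2 :=
  MonoidAlgebra.liftNC (AddMonoidHom.id (ZMod 2)) fun v : VSpace T => ∏ j ∈ A, v.toAdd j

theorem monomialDual_of {T : Type*} (A : Finset T) (v : VSpace T) :
    monomialDual A (MonoidAlgebra.of (ZMod 2) (VSpace T) v) = ∏ j ∈ A, v.toAdd j := by
  unfold monomialDual
  rw [MonoidAlgebra.of_apply, MonoidAlgebra.liftNC_single, AddMonoidHom.id_apply, one_mul]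

theorem toAdd_prod_basisVec {T : Type*} [DecidableEq T] (C : Finset T) (l : T) :
    (∏ j ∈ C, basisVec j : VSpace T).toAdd l = if l ∈ C then 1 else 0 := by
  rw [toAdd_prod, Finset.sum_apply]
  simp [basisVec, Pi.single_apply]

/-- Expanding t_B, the value counts the sets C with A ⊆ C ⊆ B. For A ⊆ B there are 2^{|B| - |A|} of
them, which is odd only for A = B. -/
theorem monomialDual_groupAlgMonomial {T : Type*} [DecidableEq T] (A B : Finset T) :
    monomialDual A (groupAlgMonomial B) = if A = B then 1 else 0 := by
  have h1 : ∀ C : Finset T, monomialDual A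
      (MonoidAlgebra.of (ZMod 2) (VSpace T) (∏ j ∈ C, basisVec j)) = if A ≤ C then 1 else 0 := by
    intro C
    rw [monomialDual_of]
    simp only [toAdd_prod_basisVec]
    rw [Finset.prod_ite_zero]
    simp [Finset.subset_iff]
  rw [groupAlgMonomial_eq_sum, map_sum, Finset.sum_congr rfl fun C _ => h1 C, ← Finset.sum_filter,
    Finset.sum_const, nsmul_eq_mul, mul_one]
  have h2 : B.powerset.filter (fun C => A ≤ C) = Finset.Icc A B := by
    ext C
    simp [and_comm]
  rw [h2]
  by_cases hAB : A ⊆ B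
  · rw [Finset.card_Icc_finset hAB]
    split_ifs with h
    · simp [h]
    · have hlt : A.card < B.card := Finset.card_lt_card (hAB.ssubset_of_ne h)
      obtain ⟨m, hm⟩ : ∃ m, B.card - A.card = m + 1 := ⟨B.card - A.card - 1, by omega⟩
      rw [hm, pow_succ, Nat.cast_mul]
      exact (congrArg _ (by decide : ((2 : ℕ) : ZMod 2) = 0)).trans (mul_zero _)
  · rw [Finset.Icc_eq_empty hAB, Finset.card_empty, Nat.cast_zero, if_neg]
    rintro rfl
    exact hAB subset_rfl

/-! ### Spaces with a spanning family and a dual family of functionals -/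

theorem eq_sum_of_dual_of_closure_eq_top {ι M : Type*} [Fintype ι] [DecidableEq ι] [AddCommGroup M]
    [Module (ZMod 2) M] (b : ι → M) (F : ι → M →+ ZMod 2)
    (hF : ∀ i j, F i (b j) = if i = j then 1 else 0)
    (hb : AddSubgroup.closure (Set.range b) = ⊤) (m : M) : m = ∑ i, F i m • b i := by
  have hm : m ∈ AddSubgroup.closure (Set.range b) := by rw [hb]; trivial
  induction hm using AddSubgroup.closure_induction with
  | mem m hm => obtain ⟨j, rfl⟩ := hm; simp [hF]
  | zero => simp
  | add x y _ _ hx hy =>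
    simp only [map_add, add_smul, Finset.sum_add_distrib]
    rw [← hx, ← hy]
  | neg x _ hx =>
    simp only [map_neg, neg_smul, Finset.sum_neg_distrib]
    rw [← hx]

/-- A spanning family with a dual family is a basis: taking coordinates is inverse to forming linear
combinations. -/
theorem card_of_dual_of_closure_eq_top {ι M : Type*} [Fintype ι] [DecidableEq ι] [AddCommGroup M]
    [Module (ZMod 2) M] (b : ι → M) (F : ι → M →+ ZMod 2)
    (hF : ∀ i j, F i (b j) = if i = j then 1 else 0)
    (hb : AddSubgroup.closure (Set.range b) = ⊤) : Nat.card M = 2 ^ Fintype.card ι := by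
  have e : M ≃ (ι → ZMod 2) :=
    { toFun := fun m i => F i m
      invFun := fun a => ∑ i, a i • b i
      left_inv := fun m => (eq_sum_of_dual_of_closure_eq_top b F hF hb m).symm
      right_inv := fun a => by
        funext j
        simp only [map_sum]
        have : ∀ i, F j (a i • b i) = if j = i then a i else 0 := fun i => by
          rw [ZMod.map_smul, hF, smul_eq_mul, mul_ite, mul_one, mul_zero]
        simp [this] }
  rw [Nat.card_congr e, Nat.card_eq_fintype_card, Fintype.card_fun, ZMod.card]

/-! ### The kernel of a homomorphism to `V_T` as a module over the group algebra -/

/-- The kernel of `ψ : Γ → V_T` is identified by `j` with a module over the group algebra of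
`V_T`, conjugation corresponding to the module structure. -/
structure IsKernelModule {T Γ M : Type*} [Group Γ] [AddCommGroup M]
    [Module (MonoidAlgebra (ZMod 2) (VSpace T)) M] (ψ : Γ →* VSpace T)
    (j : Multiplicative M →* Γ) : Prop where
  injective : Function.Injective j
  range_eq : j.range = ψ.ker
  conj : ∀ p m, p * j (.ofAdd m) =
    j (.ofAdd (MonoidAlgebra.of (ZMod 2) (VSpace T) (ψ p) • m)) * p

/-- Conjugation on the kernel is trivial for elements of the kernel, which is commutative, so it
descends to V_T. As the kernel has exponent 2, this is a representation over 𝔽₂, that is, a module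
over the group algebra. -/
theorem exists_isKernelModule.{u, v} {T : Type v} {Γ : Type u} [Group Γ] (ψ : Γ →* VSpace T)
    (hψ : Function.Surjective ψ) (hK : IsF2VectorSpace ψ.ker) :
    ∃ (M : Type u) (_ : AddCommGroup M) (_ : Module (MonoidAlgebra (ZMod 2) (VSpace T)) M)
      (j : Multiplicative M →* Γ), IsKernelModule ψ j := by
  let _ : CommGroup ψ.ker :=
    { (inferInstance : Group ψ.ker) with
      mul_comm := fun a b => Subtype.ext (hK.1 a a.2 b b.2) }
  let _ : Module (ZMod 2) (Additive ψ.ker) := AddCommGroup.zmodModule (fun x => by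
    apply Additive.toMul.injective
    exact Subtype.ext (hK.2 x.toMul x.toMul.2))
  have hconj : ∀ p q : Γ, ψ p = ψ q → ∀ a : ψ.ker,
      MulAut.conjNormal p a = MulAut.conjNormal q a := by
    intro p q hpq a
    apply Subtype.ext
    rw [MulAut.conjNormal_apply, MulAut.conjNormal_apply]
    have hmem : q⁻¹ * p ∈ ψ.ker := by
      rw [MonoidHom.mem_ker, map_mul, map_inv, hpq, inv_mul_cancel]
    have hcomm := hK.1 _ hmem a a.2
    have : p = q * (q⁻¹ * p) := by group
    calc p * a * p⁻¹ = q * ((q⁻¹ * p) * a) * p⁻¹ := by group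
      _ = q * (a * (q⁻¹ * p)) * p⁻¹ := by rw [hcomm]
      _ = _ := by group
  -- A set-theoretic section suffices: by `hconj` the action does not depend on the chosen lift.
  let σ := Function.surjInv hψ
  have hσ : ∀ v, ψ (σ v) = v := Function.surjInv_eq hψ
  let ρ : Representation (ZMod 2) (VSpace T) (Additive ψ.ker) :=
    { toFun := fun v => AddMonoidHom.toZModLinearMap 2
        (MonoidHom.toAdditive (MulAut.conjNormal (H := ψ.ker) (σ v)).toMonoidHom)
      map_one' := by
        refine LinearMap.ext fun a => Additive.toMul.injective ?_
        change MulAut.conjNormal (σ 1) a.toMul = a.toMul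
        rw [hconj (σ 1) 1 (by rw [hσ, map_one]), map_one]
        rfl
      map_mul' := fun v w => by
        refine LinearMap.ext fun a => Additive.toMul.injective ?_
        change MulAut.conjNormal (σ (v * w)) a.toMul =
          MulAut.conjNormal (σ v) (MulAut.conjNormal (σ w) a.toMul)
        rw [hconj (σ (v * w)) (σ v * σ w) (by rw [map_mul, hσ, hσ, hσ]), map_mul]
        rfl }
  let _ : Module (MonoidAlgebra (ZMod 2) (VSpace T)) (Additive ψ.ker) :=
    Module.compHom (Additive ψ.ker) ρ.asAlgebraHom.toRingHom
  refine ⟨Additive ψ.ker, inferInstance, inferInstance,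
    { toFun := fun a => a.toAdd.toMul.1
      map_one' := rfl
      map_mul' := fun _ _ => rfl }, fun a b h => ?_, ?_, fun p m => ?_⟩
  · exact Multiplicative.toAdd.injective (Additive.toMul.injective (Subtype.ext h))
  · ext p
    constructor
    · rintro ⟨a, rfl⟩
      exact a.toAdd.toMul.2
    · intro hp
      exact ⟨.ofAdd (.ofMul ⟨p, hp⟩), rfl⟩
  · have : MonoidAlgebra.of (ZMod 2) (VSpace T) (ψ p) • m = ρ (ψ p) m := by
      change ρ.asAlgebraHom (MonoidAlgebra.of (ZMod 2) (VSpace T) (ψ p)) m = _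
      rw [Representation.asAlgebraHom_of]
    rw [this]
    change p * m.toMul.1 = (MulAut.conjNormal (σ (ψ p)) m.toMul : ψ.ker).1 * p
    rw [hconj (σ (ψ p)) p (hσ _), MulAut.conjNormal_apply, inv_mul_cancel_right]

/-! ### Generators and relations of the kernel -/

theorem map_ofAdd_mul_self {T Γ M : Type*} [Group Γ] [AddCommGroup M]
    [Module (MonoidAlgebra (ZMod 2) (VSpace T)) M] (j : Multiplicative M →* Γ) (a : M) :
    j (.ofAdd a) * j (.ofAdd a) = 1 := by
  rw [← map_mul, ← ofAdd_add, add_self_eq_zero_of_groupAlg (T := T), ofAdd_zero, map_one]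

/-- The first element of the `i`-th block. -/
def blockBase {n : ℕ} {k : Fin n → ℕ} (hk : ∀ i, 0 < k i) (i : Fin n) : BlockIndex k :=
  ⟨i, ⟨0, hk i⟩⟩

/-- The kernel of `ψ` is identified with the module `M`, in which `d x` corresponds to
`g_x h_i`, for `x` in the `i`-th block, and `c i l` to `[h_i, h_l]`, where `h_i` is the first
generator of the `i`-th block. -/
structure IsBlockKernel {n : ℕ} {k : Fin n → ℕ} (hk : ∀ i, 0 < k i) {Γ M : Type*} [Group Γ]
    [AddCommGroup M] [Module (MonoidAlgebra (ZMod 2) (VSpace (Fin n))) M]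
    (ψ : Γ →* VSpace (Fin n)) (g : BlockIndex k → Γ) (j : Multiplicative M →* Γ)
    (d : BlockIndex k → M) (c : Fin n → Fin n → M) : Prop where
  isKernelModule : IsKernelModule ψ j
  map_gen : ∀ x, ψ (g x) = basisVec x.1
  gen_mul_self : ∀ x, g x * g x = 1
  map_d : ∀ x, j (.ofAdd (d x)) = g x * g (blockBase hk x.1)
  map_c : ∀ i l, j (.ofAdd (c i l)) =
    g (blockBase hk i) * g (blockBase hk l) * g (blockBase hk i) * g (blockBase hk l)

theorem exists_isBlockKernel {n : ℕ} {k : Fin n → ℕ} (hk : ∀ i, 0 < k i) {Γ M : Type*} [Group Γ]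
    [AddCommGroup M] [Module (MonoidAlgebra (ZMod 2) (VSpace (Fin n))) M]
    {ψ : Γ →* VSpace (Fin n)} {g : BlockIndex k → Γ} {j : Multiplicative M →* Γ}
    (hj : IsKernelModule ψ j) (hψ : ∀ x, ψ (g x) = basisVec x.1) (hg : ∀ x, g x ^ 2 = 1) :
    ∃ d c, IsBlockKernel hk ψ g j d c := by
  have hd : ∀ x : BlockIndex k, ∃ m, j (.ofAdd m) = g x * g (blockBase hk x.1) := fun x => by
    have : g x * g (blockBase hk x.1) ∈ j.range := by
      rw [hj.range_eq, MonoidHom.mem_ker, map_mul, hψ, hψ]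
      exact vspace_mul_self _
    obtain ⟨m, hm⟩ := this
    exact ⟨m.toAdd, hm⟩
  have hc : ∀ i l, ∃ m, j (.ofAdd m) =
      g (blockBase hk i) * g (blockBase hk l) * g (blockBase hk i) * g (blockBase hk l) :=
    fun i l => by
    have : g (blockBase hk i) * g (blockBase hk l) * g (blockBase hk i) * g (blockBase hk l) ∈
        j.range := by
      rw [hj.range_eq, MonoidHom.mem_ker, mul_assoc, map_mul, map_mul]
      exact vspace_mul_self _
    obtain ⟨m, hm⟩ := this
    exact ⟨m.toAdd, hm⟩
  choose d hd using hd
  choose c hc using hc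
  exact ⟨d, c, hj, hψ, fun x => by rw [← pow_two, hg], hd, hc⟩

namespace IsBlockKernel

variable {n : ℕ} {k : Fin n → ℕ} {hk : ∀ i, 0 < k i} {Γ M : Type*} [Group Γ]
    [AddCommGroup M] [Module (MonoidAlgebra (ZMod 2) (VSpace (Fin n))) M]
    {ψ : Γ →* VSpace (Fin n)} {g : BlockIndex k → Γ} {j : Multiplicative M →* Γ}
    {d : BlockIndex k → M} {c : Fin n → Fin n → M}

theorem ext_of_map_eq (h : IsBlockKernel hk ψ g j d c) {a b : M}
    (hab : j (.ofAdd a) = j (.ofAdd b)) : a = b :=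
  Multiplicative.ofAdd.injective (h.isKernelModule.injective hab)

theorem mul_map (h : IsBlockKernel hk ψ g j d c) (x : BlockIndex k) (a : M) :
    g x * j (.ofAdd a) =
      j (.ofAdd (MonoidAlgebra.of (ZMod 2) (VSpace (Fin n)) (basisVec x.1) • a)) * g x := by
  rw [h.isKernelModule.conj, h.map_gen]

theorem inv_gen (h : IsBlockKernel hk ψ g j d c) (x : BlockIndex k) : (g x)⁻¹ = g x :=
  inv_eq_of_mul_eq_one_left (h.gen_mul_self x)

theorem d_base (h : IsBlockKernel hk ψ g j d c) (i : Fin n) : d (blockBase hk i) = 0 :=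
  h.ext_of_map_eq (by
    rw [h.map_d, ofAdd_zero, map_one]
    exact h.gen_mul_self _)

/-- Conjugating g_x h_i by g_x gives h_i g_x, the inverse of g_x h_i, which equals g_x h_i because
the kernel has exponent 2. -/
theorem onePlus_smul_d (h : IsBlockKernel hk ψ g j d c) (x : BlockIndex k) :
    onePlus x.1 • d x = 0 := by
  have : MonoidAlgebra.of (ZMod 2) (VSpace (Fin n)) (basisVec x.1) • d x = d x := by
    apply h.ext_of_map_eq
    have h1 := h.mul_map x (d x)
    have h2 := map_ofAdd_mul_self (T := Fin n) j (d x)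
    rw [h.map_d, ← mul_assoc, h.gen_mul_self, one_mul] at h1
    have h3 : j (.ofAdd (d x)) = (j (.ofAdd (d x)))⁻¹ := eq_inv_of_mul_eq_one_left h2
    rw [← mul_inv_eq_iff_eq_mul] at h1
    rw [h3, h.map_d, ← h1, mul_inv_rev, h.inv_gen (blockBase hk x.1)]
  rw [add_smul, one_smul, this, add_self_eq_zero_of_groupAlg (T := Fin n)]

theorem c_self (h : IsBlockKernel hk ψ g j d c) (i : Fin n) : c i i = 0 :=
  h.ext_of_map_eq (by
    rw [h.map_c, ofAdd_zero, map_one, h.gen_mul_self, one_mul, h.gen_mul_self])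

theorem c_comm (h : IsBlockKernel hk ψ g j d c) (i l : Fin n) : c i l = c l i := by
  apply h.ext_of_map_eq
  have h2 : j (.ofAdd (c i l)) = (j (.ofAdd (c i l)))⁻¹ :=
    eq_inv_of_mul_eq_one_left (map_ofAdd_mul_self (T := Fin n) j (c i l))
  rw [h2, h.map_c, h.map_c]
  simp only [mul_inv_rev, h.inv_gen, mul_assoc]

/-- Conjugating [h_i, h_l] by the involution h_i gives [h_l, h_i], which is the same element by
`c_comm`. -/
theorem onePlus_smul_c_left (h : IsBlockKernel hk ψ g j d c) (i l : Fin n) :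
    onePlus i • c i l = 0 := by
  have : MonoidAlgebra.of (ZMod 2) (VSpace (Fin n)) (basisVec i) • c i l = c i l := by
    conv_rhs => rw [h.c_comm]
    apply h.ext_of_map_eq
    have h1 := h.mul_map (blockBase hk i) (c i l)
    rw [← mul_inv_eq_iff_eq_mul] at h1
    change _ = j (.ofAdd (MonoidAlgebra.of (ZMod 2) (VSpace (Fin n)) (basisVec i) • c i l)) at h1
    rw [← h1, h.map_c, h.map_c, h.inv_gen]
    simp only [← mul_assoc, h.gen_mul_self, one_mul]
  rw [add_smul, one_smul, this, add_self_eq_zero_of_groupAlg (T := Fin n)]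

theorem onePlus_smul_c_right (h : IsBlockKernel hk ψ g j d c) (i l : Fin n) :
    onePlus l • c i l = 0 := by
  rw [h.c_comm, h.onePlus_smul_c_left]

theorem gen_mul_gen (h : IsBlockKernel hk ψ g j d c) (i l : Fin n) :
    g (blockBase hk i) * g (blockBase hk l) =
      j (.ofAdd (c i l)) * (g (blockBase hk l) * g (blockBase hk i)) := by
  rw [h.map_c, mul_assoc _ (g (blockBase hk l)) (g (blockBase hk l) * _),
    ← mul_assoc _ _ (g (blockBase hk i)),
    h.gen_mul_self, one_mul, mul_assoc, h.gen_mul_self, mul_one]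

/-- A form of the Hall–Witt identity. The word h_i h_l h_m is reversed to h_m h_l h_i by adjacent
swaps in two different orders; each swap costs a commutator, which is moved to the front by
conjugation. Comparing the two kernel factors gives the relation. -/
theorem jacobi (h : IsBlockKernel hk ψ g j d c) (i l m : Fin n) :
    onePlus m • c i l + onePlus i • c l m + onePlus l • c i m = 0 := by
  set e := fun i : Fin n => MonoidAlgebra.of (ZMod 2) (VSpace (Fin n)) (basisVec i) with he
  set y := fun i : Fin n => g (blockBase hk i) with hy
  have hs : ∀ i l, y i * y l = j (.ofAdd (c i l)) * (y l * y i) := h.gen_mul_gen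
  have hm : ∀ i a, y i * j (.ofAdd a) = j (.ofAdd (e i • a)) * y i :=
    fun i a => h.mul_map (blockBase hk i) a
  have h1 : y i * y l * y m =
      j (.ofAdd (c i l + e l • c i m + c l m)) * (y m * y l * y i) := by
    calc y i * y l * y m = j (.ofAdd (c i l)) * (y l * (y i * y m)) := by
          rw [hs i l]; simp only [mul_assoc]
      _ = j (.ofAdd (c i l)) * ((y l * j (.ofAdd (c i m))) * (y m * y i)) := by
          rw [hs i m]; simp only [mul_assoc]
      _ = j (.ofAdd (c i l)) * (j (.ofAdd (e l • c i m)) * ((y l * y m) * y i)) := by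
          rw [hm]; simp only [mul_assoc]
      _ = _ := by rw [hs l m]; simp only [ofAdd_add, map_mul, mul_assoc]
  have h2 : y i * y l * y m =
      j (.ofAdd (e i • c l m + c i m + e m • c i l)) * (y m * y l * y i) := by
    calc y i * y l * y m = (y i * j (.ofAdd (c l m))) * (y m * y l) := by
          rw [mul_assoc, hs l m]; simp only [mul_assoc]
      _ = j (.ofAdd (e i • c l m)) * ((y i * y m) * y l) := by
          rw [hm]; simp only [mul_assoc]
      _ = j (.ofAdd (e i • c l m)) * (j (.ofAdd (c i m)) * (y m * (y i * y l))) := by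
          rw [hs i m]; simp only [mul_assoc]
      _ = j (.ofAdd (e i • c l m)) * (j (.ofAdd (c i m)) *
          ((y m * j (.ofAdd (c i l))) * (y l * y i))) := by
          rw [hs i l]; simp only [mul_assoc]
      _ = _ := by rw [hm]; simp only [ofAdd_add, map_mul, mul_assoc]
  have h3 := h.ext_of_map_eq (mul_right_cancel (h1.symm.trans h2))
  have h4 := add_self_eq_zero_of_groupAlg (T := Fin n) (c i l + e l • c i m + c l m)
  nth_rewrite 2 [h3] at h4
  rw [← h4]
  simp only [add_smul, one_smul]
  change c i l + e m • c i l + (c l m + e i • c l m) + (c i m + e l • c i m) = _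
  abel

end IsBlockKernel

/-! ### A spanning family of the kernel indexed by admissible pairs -/

/-- The element of the kernel with index `(x, A)`: the multiple `t_A d_x` if `x` is not the first
element of its block `i`, and `t_{A - {m}} c_{i,m}`, where `m` is the maximum of `A`, if it is. -/
noncomputable def blockMonomial {n : ℕ} {k : Fin n → ℕ} (hk : ∀ i, 0 < k i) {M : Type*}
    [AddCommGroup M] [Module (MonoidAlgebra (ZMod 2) (VSpace (Fin n))) M]
    (d : BlockIndex k → M) (c : Fin n → Fin n → M) (x : BlockIndex k) (A : Finset (Fin n)) : M :=
  if x = blockBase hk x.1 then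
    -- The value 0 at the empty set plays no role: for a first element of a block, admissibility
    -- forces `A` to be nonempty.
    if h : A.Nonempty then groupAlgMonomial (A.erase (A.max' h)) • c x.1 (A.max' h) else 0
  else groupAlgMonomial A • d x

theorem blockMonomial_blockBase {n : ℕ} {k : Fin n → ℕ} (hk : ∀ i, 0 < k i) {M : Type*}
    [AddCommGroup M] [Module (MonoidAlgebra (ZMod 2) (VSpace (Fin n))) M]
    (d : BlockIndex k → M) (c : Fin n → Fin n → M) (i : Fin n) {A : Finset (Fin n)}
    (h : A.Nonempty) : blockMonomial hk d c (blockBase hk i) A =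
      groupAlgMonomial (A.erase (A.max' h)) • c i (A.max' h) :=
  (if_pos rfl).trans (dif_pos h)

/-- The pairs `(x, A)` indexing the basis of the kernel: `A` does not contain the block `i` of
`x`, and, if `x` is the first element of its block, `A` contains an element larger than `i`. -/
def IsAdmissible {n : ℕ} {k : Fin n → ℕ} (hk : ∀ i, 0 < k i)
    (q : BlockIndex k × Finset (Fin n)) : Prop :=
  q.1.1 ∉ q.2 ∧ ¬(q.1 = blockBase hk q.1.1 ∧ ∀ l ∈ q.2, l < q.1.1)

/-- The normal form for commutators: here l is the maximum of A ∪ {l}, so the element is the member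
of the family with index (h_i, A ∪ {l}). -/
theorem monomial_smul_c_mem_of_lt {n : ℕ} {k : Fin n → ℕ} (hk : ∀ i, 0 < k i) {M : Type*}
    [AddCommGroup M] [Module (MonoidAlgebra (ZMod 2) (VSpace (Fin n))) M]
    (d : BlockIndex k → M) (c : Fin n → Fin n → M) {i l : Fin n}
    {A : Finset (Fin n)} (hi : i ∉ A) (hl : l ∉ A) (hil : i < l) (hA : ∀ a ∈ A, a < l) :
    groupAlgMonomial A • c i l ∈ AddSubgroup.closure
      (Set.range fun q : {q // IsAdmissible hk q} => blockMonomial hk d c q.1.1 q.1.2) := by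
  refine AddSubgroup.subset_closure ⟨⟨(blockBase hk i, insert l A), ?_, ?_⟩, ?_⟩
  · simp [blockBase, hi, hil.ne]
  · exact fun hh => lt_asymm hil (hh.2 l (Finset.mem_insert_self l A))
  · have hmax : (insert l A).max' (Finset.insert_nonempty l A) = l := by
      refine le_antisymm (Finset.max'_le _ _ _ fun a ha => ?_)
        (Finset.le_max' _ _ (Finset.mem_insert_self l A))
      rcases Finset.mem_insert.1 ha with rfl | ha
      · exact le_rfl
      · exact (hA a ha).le
    change blockMonomial hk d c (blockBase hk i) (insert l A) = _
    rw [blockMonomial_blockBase hk d c i (Finset.insert_nonempty l A), hmax,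
      Finset.erase_insert hl]

namespace IsBlockKernel

variable {n : ℕ} {k : Fin n → ℕ} {hk : ∀ i, 0 < k i} {Γ M : Type*} [Group Γ]
    [AddCommGroup M] [Module (MonoidAlgebra (ZMod 2) (VSpace (Fin n))) M]
    {ψ : Γ →* VSpace (Fin n)} {g : BlockIndex k → Γ} {j : Multiplicative M →* Γ}
    {d : BlockIndex k → M} {c : Fin n → Fin n → M}

theorem monomial_smul_d_mem (h : IsBlockKernel hk ψ g j d c) (x : BlockIndex k)
    (A : Finset (Fin n)) : groupAlgMonomial A • d x ∈ AddSubgroup.closure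
      (Set.range fun q : {q // IsAdmissible hk q} => blockMonomial hk d c q.1.1 q.1.2) := by
  by_cases hA : x.1 ∈ A
  · rw [groupAlgMonomial_eq_erase_mul hA, mul_smul, h.onePlus_smul_d, smul_zero]
    exact zero_mem _
  by_cases hx : x = blockBase hk x.1
  · rw [hx, h.d_base, smul_zero]
    exact zero_mem _
  refine AddSubgroup.subset_closure ⟨⟨(x, A), hA, fun h => hx h.1⟩, ?_⟩
  exact if_neg hx

/-- Straightening. The multiple vanishes or is in normal form unless m = max A exceeds both i and l.
In that case the Jacobi identity replaces (1 + e_m) c_{il} by (1 + e_i) c_{lm} + (1 + e_l) c_{im},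
and both terms are in normal form because m is the largest index. -/
theorem monomial_smul_c_mem (h : IsBlockKernel hk ψ g j d c) (i l : Fin n)
    (A : Finset (Fin n)) : groupAlgMonomial A • c i l ∈ AddSubgroup.closure
      (Set.range fun q : {q // IsAdmissible hk q} => blockMonomial hk d c q.1.1 q.1.2) := by
  by_cases hi : i ∈ A
  · rw [groupAlgMonomial_eq_erase_mul hi, mul_smul, h.onePlus_smul_c_left, smul_zero]
    exact zero_mem _
  by_cases hl : l ∈ A
  · rw [groupAlgMonomial_eq_erase_mul hl, mul_smul, h.onePlus_smul_c_right, smul_zero]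
    exact zero_mem _
  rcases eq_or_ne i l with rfl | hil
  · rw [h.c_self, smul_zero]
    exact zero_mem _
  by_cases hbl : i < l ∧ ∀ a ∈ A, a < l
  · exact monomial_smul_c_mem_of_lt hk d c hi hl hbl.1 hbl.2
  by_cases hbi : l < i ∧ ∀ a ∈ A, a < i
  · rw [h.c_comm]
    exact monomial_smul_c_mem_of_lt hk d c hl hi hbi.1 hbi.2
  have hne : A.Nonempty := by
    rw [Finset.nonempty_iff_ne_empty]
    rintro rfl
    rcases lt_or_gt_of_ne hil with hlt | hlt
    · exact hbl ⟨hlt, by simp⟩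
    · exact hbi ⟨hlt, by simp⟩
  set m := A.max' hne with hm
  have hmA : m ∈ A := A.max'_mem hne
  have hle : ∀ a ∈ A, a ≤ m := fun a ha => A.le_max' a ha
  have him : i < m := by
    by_contra hcon
    have h1 : ∀ a ∈ A, a < i := fun a ha =>
      lt_of_le_of_ne ((hle a ha).trans (not_lt.1 hcon)) fun e => hi (e ▸ ha)
    rcases lt_or_gt_of_ne hil with hlt | hlt
    · exact hbl ⟨hlt, fun a ha => (h1 a ha).trans hlt⟩
    · exact hbi ⟨hlt, h1⟩
  have hlm : l < m := by
    by_contra hcon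
    have h1 : ∀ a ∈ A, a < l := fun a ha =>
      lt_of_le_of_ne ((hle a ha).trans (not_lt.1 hcon)) fun e => hl (e ▸ ha)
    exact hbl ⟨him.trans (h1 m hmA), h1⟩
  have hj := h.jacobi i l m
  have hj' : onePlus m • c i l = onePlus i • c l m + onePlus l • c i m := by
    rw [add_assoc] at hj
    rw [eq_neg_of_add_eq_zero_left hj]
    exact neg_eq_of_add_eq_zero_left (add_self_eq_zero_of_groupAlg (T := Fin n) _)
  have hem : ∀ a ∈ A.erase m, a < m := fun a ha =>
    lt_of_le_of_ne (hle a (Finset.mem_of_mem_erase ha)) (Finset.ne_of_mem_erase ha)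
  have hie : i ∉ A.erase m := fun hh => hi (Finset.mem_of_mem_erase hh)
  have hle' : l ∉ A.erase m := fun hh => hl (Finset.mem_of_mem_erase hh)
  rw [groupAlgMonomial_eq_erase_mul hmA, mul_smul, hj', smul_add, ← mul_smul, ← mul_smul,
    ← groupAlgMonomial_insert hie, ← groupAlgMonomial_insert hle']
  refine add_mem (monomial_smul_c_mem_of_lt hk d c ?_ ?_ hlm ?_)
    (monomial_smul_c_mem_of_lt hk d c ?_ ?_ him ?_)
  · simp [hil.symm, hl]
  · simp [him.ne']
  · simpa [him] using hem
  · simp [hil, hi]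
  · simp [hlm.ne']
  · simpa [hlm] using hem

/-- If the generators generate `Γ`, then the elements `d x` and `c i l` generate the kernel as a
module. -/
theorem span_eq_top (h : IsBlockKernel hk ψ g j d c)
    (htop : Subgroup.closure (Set.range g) = ⊤) :
    Submodule.span (MonoidAlgebra (ZMod 2) (VSpace (Fin n)))
      (Set.range d ∪ Set.range (fun q : Fin n × Fin n => c q.1 q.2)) = ⊤ := by
  set N := Submodule.span (MonoidAlgebra (ZMod 2) (VSpace (Fin n)))
      (Set.range d ∪ Set.range (fun q : Fin n × Fin n => c q.1 q.2)) with hN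
  -- Modulo `L` the h_i commute and every g_x equals the first generator of its block. Hence Γ → Γ/L
  -- factors through `ψ`, so the kernel of `ψ` is contained in `L`.
  let L : Subgroup Γ := (AddSubgroup.toSubgroup N.toAddSubgroup).map j
  have hL : ∀ m ∈ N, j (.ofAdd m) ∈ L := fun m hm => ⟨.ofAdd m, hm, rfl⟩
  have hnormal : L.Normal := ⟨by
    rintro _ ⟨m, hm, rfl⟩ p
    have := h.isKernelModule.conj p m.toAdd
    rw [ofAdd_toAdd, ← mul_inv_eq_iff_eq_mul] at this
    rw [this]
    exact hL _ (N.smul_mem _ hm)⟩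
  let y : Fin n → Γ ⧸ L := fun i => (g (blockBase hk i) : Γ ⧸ L)
  obtain ⟨f, hf⟩ := exists_vspace_hom y (fun i l => by
      change (g (blockBase hk i) : Γ ⧸ L) * (g (blockBase hk l) : Γ ⧸ L) =
        (g (blockBase hk l) : Γ ⧸ L) * (g (blockBase hk i) : Γ ⧸ L)
      rw [← QuotientGroup.mk_mul, ← QuotientGroup.mk_mul, h.gen_mul_gen, QuotientGroup.mk_mul,
        (QuotientGroup.eq_one_iff _).2 (hL _ (Submodule.subset_span (Or.inr ⟨(i, l), rfl⟩))),
        one_mul]) (fun i => by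
      change (g (blockBase hk i) : Γ ⧸ L) ^ 2 = 1
      rw [← QuotientGroup.mk_pow, pow_two, h.gen_mul_self, QuotientGroup.mk_one])
  have hcomp : f.comp ψ = QuotientGroup.mk' L := by
    refine MonoidHom.eq_of_eqOn_dense htop ?_
    rintro _ ⟨x, rfl⟩
    rw [MonoidHom.comp_apply, h.map_gen, hf, QuotientGroup.mk'_apply]
    have : g x = j (.ofAdd (d x)) * g (blockBase hk x.1) := by
      rw [h.map_d, mul_assoc, h.gen_mul_self, mul_one]
    rw [this, QuotientGroup.mk_mul,
      (QuotientGroup.eq_one_iff _).2 (hL _ (Submodule.subset_span (Or.inl ⟨x, rfl⟩))), one_mul]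
  rw [eq_top_iff]
  intro m _
  have hm : j (.ofAdd m) ∈ ψ.ker := by
    rw [← h.isKernelModule.range_eq]
    exact ⟨_, rfl⟩
  have hm' : j (.ofAdd m) ∈ L := by
    rw [← QuotientGroup.eq_one_iff, ← QuotientGroup.mk'_apply, ← hcomp, MonoidHom.comp_apply,
      MonoidHom.mem_ker.1 hm, map_one]
  obtain ⟨m', hm', he⟩ := hm'
  rw [h.isKernelModule.injective he] at hm'
  exact hm'

theorem closure_blockMonomial_eq_top (h : IsBlockKernel hk ψ g j d c)
    (htop : Subgroup.closure (Set.range g) = ⊤) : AddSubgroup.closure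
      (Set.range fun q : {q // IsAdmissible hk q} => blockMonomial hk d c q.1.1 q.1.2) = ⊤ := by
  rw [eq_top_iff]
  intro m _
  have hm : m ∈ Submodule.span (MonoidAlgebra (ZMod 2) (VSpace (Fin n)))
      (Set.range d ∪ Set.range (fun q : Fin n × Fin n => c q.1 q.2)) := by
    rw [h.span_eq_top htop]; trivial
  induction hm using Submodule.closure_induction with
  | zero => exact zero_mem _
  | add a b _ _ ha hb => exact add_mem (ha trivial) (hb trivial)
  | smul_mem r a ha =>
    refine smul_mem_of_forall_monomial _ _ (fun A => ?_) r
    rcases ha with ⟨x, rfl⟩ | ⟨q, rfl⟩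
    · exact h.monomial_smul_d_mem x A
    · exact h.monomial_smul_c_mem q.1 q.2 A

end IsBlockKernel

/-! ### Detecting the kernel by homomorphisms to `𝔽₂[𝔽₂^n] ⋊ 𝔽₂^n` -/

/-- The endomorphism of `V_T` that sets the coordinate `i` to zero. -/
def eraseCoord {T : Type*} [DecidableEq T] (i : T) : VSpace T →* VSpace T :=
  AddMonoidHom.toMultiplicative
    { toFun := fun v l => if l = i then 0 else v l
      map_zero' := funext fun l => ite_self _
      map_add' := fun v w => funext fun l => by by_cases h : l = i <;> simp [h] }

theorem eraseCoord_basisVec {T : Type*} [DecidableEq T] (i l : T) :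
    eraseCoord i (basisVec l) = if l = i then 1 else basisVec l := by
  apply Multiplicative.toAdd.injective
  ext a
  change (if a = i then (0 : ZMod 2) else (Pi.single l 1 : T → ZMod 2) a) = _
  split_ifs with h1 h2 h2
  · rfl
  · subst h1
    change (0 : ZMod 2) = (Pi.single l 1 : T → ZMod 2) a
    rw [Pi.single_eq_of_ne (Ne.symm h2)]
  · subst h2
    change (Pi.single l 1 : T → ZMod 2) a = 0
    rw [Pi.single_eq_of_ne h1]
  · rfl

/-- The factor 1 + e_i becomes 1 + 1 = 0, and the other factors are fixed. -/
theorem mapDomain_eraseCoord_groupAlgMonomial {T : Type*} [DecidableEq T] (i : T)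
    (A : Finset T) : MonoidAlgebra.mapDomainRingHom (ZMod 2) (eraseCoord i) (groupAlgMonomial A) =
      if i ∈ A then 0 else groupAlgMonomial A := by
  have h1 : ∀ l, MonoidAlgebra.mapDomainRingHom (ZMod 2) (eraseCoord i) (onePlus l) =
      if l = i then 0 else onePlus l := fun l => by
    have : MonoidAlgebra.mapDomainRingHom (ZMod 2) (eraseCoord i)
        (MonoidAlgebra.of (ZMod 2) (VSpace T) (basisVec l)) =
        MonoidAlgebra.of (ZMod 2) (VSpace T) (eraseCoord i (basisVec l)) := by simp
    rw [map_add, map_one, this, eraseCoord_basisVec]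
    split_ifs
    · rw [map_one, groupAlg_add_self]
    · rfl
  unfold groupAlgMonomial
  rw [map_prod, Finset.prod_congr rfl fun l _ => h1 l]
  split_ifs with h
  · exact Finset.prod_eq_zero h (if_pos rfl)
  · exact Finset.prod_congr rfl fun l hl => if_neg fun e : l = i => h (e ▸ hl)

theorem pointerElt_mul_self (T : Type*) : pointerElt T * pointerElt T = 1 := by
  unfold pointerElt
  rw [← map_mul, ← ofAdd_add, groupAlg_add_self, ofAdd_zero, map_one]

theorem transElt_mul_self {T : Type*} [DecidableEq T] (t : T) : transElt t * transElt t = 1 := by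
  unfold transElt
  rw [← map_mul, vspace_mul_self, map_one]

theorem transElt_comm {T : Type*} [DecidableEq T] (s t : T) :
    transElt s * transElt t = transElt t * transElt s := by
  unfold transElt
  rw [← map_mul, ← map_mul, mul_comm]

/-- The commutator of a translation and the unit element of the group algebra. -/
theorem transElt_commutator_pointerElt {T : Type*} [DecidableEq T] (t : T) :
    transElt t * pointerElt T * transElt t * pointerElt T =
      SemidirectProduct.inl (.ofAdd (onePlus t)) := by
  have h1 : transElt t * pointerElt T * transElt t =
      SemidirectProduct.inl (.ofAdd (MonoidAlgebra.of (ZMod 2) (VSpace T) (basisVec t))) := by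
    have h2 : (transElt t)⁻¹ = transElt t := inv_eq_of_mul_eq_one_left (transElt_mul_self t)
    conv_lhs => arg 2; rw [← h2]
    unfold transElt pointerElt
    rw [← map_inv, ← SemidirectProduct.inl_aut]
    congr 1
    change Multiplicative.ofAdd (MonoidAlgebra.of (ZMod 2) (VSpace T) (basisVec t) * 1) = _
    rw [mul_one]
  rw [h1]
  unfold pointerElt
  rw [← map_mul, ← ofAdd_add, add_comm]

theorem pointerElt_commutator_transElt {T : Type*} [DecidableEq T] (t : T) :
    pointerElt T * transElt t * pointerElt T * transElt t =
      SemidirectProduct.inl (.ofAdd (onePlus t)) := by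
  have h := congrArg (fun z => z⁻¹) (transElt_commutator_pointerElt t)
  simp only [mul_inv_rev, inv_eq_of_mul_eq_one_left (transElt_mul_self t),
    inv_eq_of_mul_eq_one_left (pointerElt_mul_self T), ← mul_assoc] at h
  rw [h, ← map_inv, ← ofAdd_neg, neg_eq_of_add_eq_zero_left (groupAlg_add_self _)]

theorem groupAlgSemidirect_mul_inl {T : Type*} (s : GroupAlgSemidirect T)
    (a : MonoidAlgebra (ZMod 2) (VSpace T)) : s * SemidirectProduct.inl (.ofAdd a) =
      SemidirectProduct.inl (.ofAdd (MonoidAlgebra.of (ZMod 2) (VSpace T) s.right * a)) * s := by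
  apply SemidirectProduct.ext
  · rw [SemidirectProduct.mul_left, SemidirectProduct.mul_left, SemidirectProduct.left_inl,
      SemidirectProduct.right_inl, map_one, mul_comm]
    rfl
  · simp

/-- A family of homomorphisms with the values of the maps `φ_x` on the generators, the targets
being embedded in `𝔽₂[𝔽₂^n] ⋊ 𝔽₂^n`. -/
def IsPointerFamily {n : ℕ} {k : Fin n → ℕ} {Γ : Type*} [Group Γ] (g : BlockIndex k → Γ)
    (χ : BlockIndex k → Γ →* GroupAlgSemidirect (Fin n)) : Prop :=
  ∀ x y, χ x (g y) =
    if y.1 = x.1 then (if y = x then pointerElt _ else 1) else transElt y.1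

namespace IsBlockKernel

variable {n : ℕ} {k : Fin n → ℕ} {hk : ∀ i, 0 < k i} {Γ M : Type*} [Group Γ]
    [AddCommGroup M] [Module (MonoidAlgebra (ZMod 2) (VSpace (Fin n))) M]
    {ψ : Γ →* VSpace (Fin n)} {g : BlockIndex k → Γ} {j : Multiplicative M →* Γ}
    {d : BlockIndex k → M} {c : Fin n → Fin n → M}
    {χ : BlockIndex k → Γ →* GroupAlgSemidirect (Fin n)}

/-- Both sides are homomorphisms in `p`, so it suffices to compare generators. Consequently `χ x`
maps the kernel of `ψ` into the group algebra. -/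
theorem right_pointer (h : IsBlockKernel hk ψ g j d c)
    (htop : Subgroup.closure (Set.range g) = ⊤) (hχ : IsPointerFamily g χ) (x : BlockIndex k)
    (p : Γ) : (χ x p).right = eraseCoord x.1 (ψ p) := by
  have : SemidirectProduct.rightHom.comp (χ x) = (eraseCoord x.1).comp ψ := by
    refine MonoidHom.eq_of_eqOn_dense htop ?_
    rintro _ ⟨y, rfl⟩
    rw [MonoidHom.comp_apply, MonoidHom.comp_apply, h.map_gen, eraseCoord_basisVec, hχ]
    split_ifs <;> simp [pointerElt, transElt]
  exact DFunLike.congr_fun this p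

/-- On the kernel a pointer family is given by semilinear maps to the group algebra. -/
theorem exists_pointer_semilinear (h : IsBlockKernel hk ψ g j d c)
    (hsurj : Function.Surjective ψ)
    (htop : Subgroup.closure (Set.range g) = ⊤) (hχ : IsPointerFamily g χ) :
    ∃ L : BlockIndex k → M →+ MonoidAlgebra (ZMod 2) (VSpace (Fin n)),
      (∀ x m, χ x (j (.ofAdd m)) = SemidirectProduct.inl (.ofAdd (L x m))) ∧
      ∀ x r m, L x (r • m) =
        MonoidAlgebra.mapDomainRingHom (ZMod 2) (eraseCoord x.1) r * L x m := by
  have hinl : ∀ x m, ∃ a, χ x (j (.ofAdd m)) = SemidirectProduct.inl (.ofAdd a) := fun x m => by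
    refine ⟨(χ x (j (.ofAdd m))).left.toAdd, SemidirectProduct.ext rfl ?_⟩
    have hm : j (.ofAdd m) ∈ ψ.ker := by
      rw [← h.isKernelModule.range_eq]
      exact ⟨_, rfl⟩
    rw [h.right_pointer htop hχ, MonoidHom.mem_ker.1 hm, map_one, SemidirectProduct.right_inl]
  choose L hL using hinl
  have hinj : ∀ a b : MonoidAlgebra (ZMod 2) (VSpace (Fin n)),
      (SemidirectProduct.inl (.ofAdd a) : GroupAlgSemidirect (Fin n)) =
        SemidirectProduct.inl (.ofAdd b) → a = b := fun a b hab =>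
    Multiplicative.ofAdd.injective (SemidirectProduct.inl_injective hab)
  refine ⟨fun x => AddMonoidHom.mk' (L x) fun a b => ?_, fun x m => hL x m, fun x r m => ?_⟩
  · apply hinj
    rw [← hL, ofAdd_add, map_mul, map_mul, hL, hL, ← map_mul, ofAdd_add]
  · have hadd : ∀ a b, L x (a + b) = L x a + L x b := fun a b => by
      apply hinj
      rw [← hL, ofAdd_add, map_mul, map_mul, hL, hL, ← map_mul, ofAdd_add]
    change L x (r • m) = _ * L x m
    have hzero : L x 0 = 0 := by simpa using hadd 0 0
    -- For a group element, lift it to Γ and apply `χ x` to the conjugation relation; the general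
    -- case follows by additivity.
    induction r using MonoidAlgebra.induction_on with
    | of v =>
      obtain ⟨p, rfl⟩ := hsurj v
      have h1 := h.isKernelModule.conj p m
      have h2 : MonoidAlgebra.mapDomainRingHom (ZMod 2) (eraseCoord x.1)
          (MonoidAlgebra.of (ZMod 2) (VSpace (Fin n)) (ψ p)) =
          MonoidAlgebra.of (ZMod 2) (VSpace (Fin n)) (χ x p).right := by
        rw [h.right_pointer htop hχ]; simp
      have h3 := congrArg (χ x) h1
      rw [map_mul, map_mul, hL, hL, groupAlgSemidirect_mul_inl] at h3
      rw [h2]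
      exact (hinj _ _ (mul_right_cancel h3)).symm
    | add a b ha hb => rw [add_smul, hadd, ha, hb, map_add, add_mul]
    | smul c a ha =>
      have hc : c = 0 ∨ c = 1 := by revert c; decide
      rcases hc with rfl | rfl
      · rw [zero_smul, zero_smul, map_zero, zero_mul, hzero]
      · rw [one_smul, ha]

theorem pointer_d (h : IsBlockKernel hk ψ g j d c) (hχ : IsPointerFamily g χ)
    {L : BlockIndex k → M →+ MonoidAlgebra (ZMod 2) (VSpace (Fin n))}
    (hL : ∀ x m, χ x (j (.ofAdd m)) = SemidirectProduct.inl (.ofAdd (L x m)))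
    (x y : BlockIndex k) : L x (d y) = if y.1 = x.1 then
      (if y = x then 1 else 0) + (if blockBase hk y.1 = x then 1 else 0) else 0 := by
  have h1 := hL x (d y)
  rw [h.map_d, map_mul, hχ, hχ] at h1
  apply Multiplicative.ofAdd.injective
  apply SemidirectProduct.inl_injective (φ := translation (Fin n))
  rw [← h1]
  change (if y.1 = x.1 then _ else _) *
    (if y.1 = x.1 then if blockBase hk y.1 = x then pointerElt _ else 1 else transElt y.1) = _
  split_ifs
  · rw [ofAdd_add, map_mul]; rfl
  · rw [add_zero, mul_one]; rfl
  · rw [zero_add, one_mul]; rfl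
  · rw [add_zero, mul_one, ofAdd_zero, map_one]
  · rw [transElt_mul_self, ofAdd_zero, map_one]

/-- Away from the block of x, both generators become translations, which commute. If one of them is
g_x, the value is the commutator of the pointer element with a translation. If one is in the block
of x but is not g_x, it becomes trivial. -/
theorem pointer_c (h : IsBlockKernel hk ψ g j d c) (hχ : IsPointerFamily g χ)
    {L : BlockIndex k → M →+ MonoidAlgebra (ZMod 2) (VSpace (Fin n))}
    (hL : ∀ x m, χ x (j (.ofAdd m)) = SemidirectProduct.inl (.ofAdd (L x m)))
    (x : BlockIndex k) {i l : Fin n} (hil : i ≠ l) : L x (c i l) =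
      if blockBase hk i = x then onePlus l else if blockBase hk l = x then onePlus i else 0 := by
  have h1 := hL x (c i l)
  have hbase : ∀ i, χ x (g (blockBase hk i)) =
      if i = x.1 then (if blockBase hk i = x then pointerElt _ else 1) else transElt i :=
    fun i => hχ x _
  rw [h.map_c, map_mul, map_mul, map_mul, hbase, hbase] at h1
  apply Multiplicative.ofAdd.injective
  apply SemidirectProduct.inl_injective (φ := translation (Fin n))
  rw [← h1]
  by_cases hi : i = x.1
  · have hl : l ≠ x.1 := fun e => hil (hi.trans e.symm)
    have hlx : blockBase hk l ≠ x := fun e => hl (congrArg Sigma.fst e)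
    rw [if_pos hi, if_neg hl, if_neg hlx]
    split_ifs
    · exact pointerElt_commutator_transElt l
    · rw [one_mul, mul_one, transElt_mul_self, ofAdd_zero, map_one]
  · have hix : blockBase hk i ≠ x := fun e => hi (congrArg Sigma.fst e)
    rw [if_neg hi, if_neg hix]
    split_ifs
    · exact transElt_commutator_pointerElt i
    · rw [mul_one, mul_one, transElt_mul_self, ofAdd_zero, map_one]
    · rename_i hl hlx
      exact absurd (congrArg Sigma.fst hlx) hl
    · rw [transElt_comm i l, mul_assoc (transElt l), transElt_mul_self, mul_one,
        transElt_mul_self, ofAdd_zero, map_one]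

end IsBlockKernel

/-! ### Functionals dual to the admissible family, and the order of the kernel -/

namespace IsBlockKernel

variable {n : ℕ} {k : Fin n → ℕ} {hk : ∀ i, 0 < k i} {Γ M : Type*} [Group Γ]
    [AddCommGroup M] [Module (MonoidAlgebra (ZMod 2) (VSpace (Fin n))) M]
    {ψ : Γ →* VSpace (Fin n)} {g : BlockIndex k → Γ} {j : Multiplicative M →* Γ}
    {d : BlockIndex k → M} {c : Fin n → Fin n → M}
    {χ : BlockIndex k → Γ →* GroupAlgSemidirect (Fin n)}

/-- In its own block, d_y = g_y h_i receives one contribution from g_y and one from h_i, and these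
cancel. So summing over a block isolates the commutators c from the elements d. -/
theorem sum_pointer_d (h : IsBlockKernel hk ψ g j d c) (hχ : IsPointerFamily g χ)
    {L : BlockIndex k → M →+ MonoidAlgebra (ZMod 2) (VSpace (Fin n))}
    (hL : ∀ x m, χ x (j (.ofAdd m)) = SemidirectProduct.inl (.ofAdd (L x m)))
    (i : Fin n) (y : BlockIndex k) : ∑ a : Fin (k i), L ⟨i, a⟩ (d y) = 0 := by
  rw [Finset.sum_congr rfl fun a _ => h.pointer_d hχ hL ⟨i, a⟩ y]
  obtain ⟨l, b⟩ := y
  dsimp only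
  split_ifs with hl
  · subst hl
    simp [blockBase, Finset.sum_add_distrib, groupAlg_add_self]
  · simp

theorem sum_pointer_c (h : IsBlockKernel hk ψ g j d c) (hχ : IsPointerFamily g χ)
    {L : BlockIndex k → M →+ MonoidAlgebra (ZMod 2) (VSpace (Fin n))}
    (hL : ∀ x m, χ x (j (.ofAdd m)) = SemidirectProduct.inl (.ofAdd (L x m)))
    (i : Fin n) {l m : Fin n} (hlm : l ≠ m) : ∑ a : Fin (k i), L ⟨i, a⟩ (c l m) =
      if l = i then onePlus m else if m = i then onePlus l else 0 := by
  rw [Finset.sum_congr rfl fun a _ => h.pointer_c hχ hL ⟨i, a⟩ hlm]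
  have hb : ∀ (l : Fin n) (a : Fin (k i)), blockBase hk l = ⟨i, a⟩ ↔ l = i ∧ a = ⟨0, hk i⟩ := by
    intro l a
    constructor
    · intro e
      obtain rfl : l = i := congrArg Sigma.fst e
      refine ⟨rfl, ?_⟩
      simpa [blockBase, eq_comm] using e
    · rintro ⟨rfl, rfl⟩
      rfl
  simp only [hb]
  by_cases hl : l = i
  · have hm : m ≠ i := fun e => hlm (hl.trans e.symm)
    simp [hl, hm]
  · by_cases hm : m = i <;> simp [hl, hm]

/-- The functionals dual to the family of elements `blockMonomial`. -/
theorem exists_dual (h : IsBlockKernel hk ψ g j d c) (hsurj : Function.Surjective ψ)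
    (htop : Subgroup.closure (Set.range g) = ⊤) (hχ : IsPointerFamily g χ) :
    ∃ F : BlockIndex k × Finset (Fin n) → M →+ ZMod 2,
      (∀ q q', IsAdmissible hk q → IsAdmissible hk q' →
        F q (blockMonomial hk d c q'.1 q'.2) = if q = q' then 1 else 0) ∧
      ∀ m, (∀ x, χ x (j (.ofAdd m)) = 1) → ∀ q, F q m = 0 := by
  obtain ⟨L, hL, hsmul⟩ := h.exists_pointer_semilinear hsurj htop hχ
  let Λ : Fin n → M →+ MonoidAlgebra (ZMod 2) (VSpace (Fin n)) :=
    fun i => ∑ a : Fin (k i), L ⟨i, a⟩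
  have hΛ : ∀ i m, Λ i m = ∑ a : Fin (k i), L ⟨i, a⟩ m := fun i m => by
    simp [Λ, AddMonoidHom.finsetSum_apply]
  have hΛsmul : ∀ i r m, Λ i (r • m) =
      MonoidAlgebra.mapDomainRingHom (ZMod 2) (eraseCoord i) r * Λ i m := fun i r m => by
    rw [hΛ, hΛ, Finset.mul_sum]
    exact Finset.sum_congr rfl fun a _ => hsmul ⟨i, a⟩ r m
  -- For x not first in its block, `L x` kills every c_{lm} with l ≠ m. For x first, the block sum
  -- kills every d_y. The two halves of the family therefore do not interact.
  refine ⟨fun q => (monomialDual q.2).comp (if q.1 = blockBase hk q.1.1 then Λ q.1.1 else L q.1),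
    ?_, ?_⟩
  · rintro ⟨x, A⟩ ⟨y, B⟩ ⟨hxA, hq⟩ ⟨hyB, hq'⟩
    dsimp only at hxA hq hyB hq' ⊢
    rw [AddMonoidHom.comp_apply]
    by_cases hy : y = blockBase hk y.1
    · obtain ⟨m, hmB, hm⟩ : ∃ m ∈ B, y.1 ≤ m := by
        by_contra hcon
        push Not at hcon
        exact hq' ⟨hy, hcon⟩
      have hB : B.Nonempty := ⟨m, hmB⟩
      obtain ⟨l, hl⟩ : ∃ l, y = blockBase hk l := ⟨_, hy⟩
      subst hl
      change l ∉ B at hyB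
      change l ≤ m at hm
      have hmax := B.max'_mem hB
      set μ := B.max' hB with hμ
      have hlμ : l < μ := lt_of_lt_of_le (lt_of_le_of_ne hm fun e => hyB (e ▸ hmB))
        (B.le_max' m hmB)
      rw [blockMonomial_blockBase hk d c l hB, ← hμ]
      by_cases hx : x = blockBase hk x.1
      · rw [if_pos hx]
        obtain ⟨i, hi⟩ : ∃ i, x = blockBase hk i := ⟨_, hx⟩
        subst hi
        change i ∉ A at hxA
        change monomialDual A (Λ i _) = _
        rw [hΛsmul, mapDomain_eraseCoord_groupAlgMonomial, hΛ, h.sum_pointer_c hχ hL i hlμ.ne]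
        by_cases hli : l = i
        · subst hli
          rw [if_pos rfl, if_neg (fun e => hyB (Finset.mem_of_mem_erase e)),
            ← groupAlgMonomial_eq_erase_mul hmax, monomialDual_groupAlgMonomial]
          simp
        · have hne : ¬((blockBase hk i, A) = (blockBase hk l, B)) := fun e =>
            hli (congrArg (fun z => z.1.1) e).symm
          rw [if_neg hli, if_neg hne]
          -- The only other nonzero value: c_{lμ} is also seen by block i = μ, with value t_{(B -
          -- {μ}) ∪ {l}}. All indices of this monomial are below i, and such a set is excluded by
          -- admissibility of (h_i, A).
          by_cases hmi : μ = i
          · have hlB : l ∉ B.erase μ := fun e => hyB (Finset.mem_of_mem_erase e)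
            rw [if_pos hmi, ← hmi, if_neg (Finset.notMem_erase μ B),
              ← groupAlgMonomial_insert hlB, monomialDual_groupAlgMonomial, if_neg]
            rintro rfl
            refine hq ⟨rfl, fun a ha => ?_⟩
            change a < i
            rw [← hmi]
            rcases Finset.mem_insert.1 ha with rfl | ha
            · exact hlμ
            · exact lt_of_le_of_ne (B.le_max' a (Finset.mem_of_mem_erase ha))
                (Finset.ne_of_mem_erase ha)
          · rw [if_neg hmi, mul_zero, map_zero]
      · rw [if_neg hx, hsmul, h.pointer_c hχ hL x hlμ.ne, if_neg, if_neg, mul_zero, map_zero,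
          if_neg]
        · intro e
          obtain rfl : x = blockBase hk l := congrArg Prod.fst e
          exact hx rfl
        · rintro rfl; exact hx rfl
        · rintro rfl; exact hx rfl
    · have hmon : blockMonomial hk d c y B = groupAlgMonomial B • d y := if_neg hy
      rw [hmon]
      by_cases hx : x = blockBase hk x.1
      · rw [if_pos hx, hΛsmul, hΛ, h.sum_pointer_d hχ hL, mul_zero, map_zero, if_neg]
        intro e
        obtain rfl : x = y := congrArg Prod.fst e
        exact hy hx
      · rw [if_neg hx, hsmul, mapDomain_eraseCoord_groupAlgMonomial, h.pointer_d hχ hL]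
        have hbx : blockBase hk y.1 ≠ x := fun e => hx (by rw [← e]; rfl)
        rw [if_neg hbx, add_zero]
        by_cases hyx : y = x
        · subst hyx
          rw [if_neg hyB, if_pos rfl, if_pos rfl, mul_one, monomialDual_groupAlgMonomial]
          simp
        · rw [if_neg hyx, ite_self, mul_zero, map_zero, if_neg]
          exact fun e => hyx (congrArg Prod.fst e).symm
  · intro m hm q
    have h0 : ∀ x, L x m = 0 := fun x => by
      have := hm x
      rw [hL] at this
      exact Multiplicative.ofAdd.injective (SemidirectProduct.inl_injective
        (this.trans (map_one _).symm))
    rw [AddMonoidHom.comp_apply]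
    split_ifs
    · rw [hΛ, Finset.sum_congr rfl fun a _ => h0 ⟨q.1.1, a⟩, Finset.sum_const_zero, map_zero]
    · rw [h0, map_zero]

end IsBlockKernel

/-- The order of the kernel in the presence of a pointer family, which detects its elements. -/
theorem card_ker_and_eq_one_of_pointer {n : ℕ} {k : Fin n → ℕ} (hk : ∀ i, 0 < k i) {Γ : Type*}
    [Group Γ] {ψ : Γ →* VSpace (Fin n)} {g : BlockIndex k → Γ}
    {χ : BlockIndex k → Γ →* GroupAlgSemidirect (Fin n)} (hsurj : Function.Surjective ψ)
    (hK : IsF2VectorSpace ψ.ker) (hψ : ∀ x, ψ (g x) = basisVec x.1) (hg : ∀ x, g x ^ 2 = 1)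
    (htop : Subgroup.closure (Set.range g) = ⊤) (hχ : IsPointerFamily g χ) :
    Nat.card ψ.ker = 2 ^ Nat.card {q // IsAdmissible hk q} ∧
      ∀ p ∈ ψ.ker, (∀ x, χ x p = 1) → p = 1 := by
  classical
  obtain ⟨M, _, _, j, hj⟩ := exists_isKernelModule ψ hsurj hK
  obtain ⟨d, c, h⟩ := exists_isBlockKernel hk hj hψ hg
  obtain ⟨F, hF, hF0⟩ := h.exists_dual hsurj htop hχ
  let _ : Module (ZMod 2) M := AddCommGroup.zmodModule fun m => by
    rw [two_smul, add_self_eq_zero_of_groupAlg (T := Fin n)]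
  let _ : Fintype {q // IsAdmissible hk q} := Fintype.ofFinite _
  have hF' : ∀ q q' : {q // IsAdmissible hk q},
      F q.1 (blockMonomial hk d c q'.1.1 q'.1.2) = if q = q' then 1 else 0 := fun q q' => by
    rw [hF q.1 q'.1 q.2 q'.2]
    simp [Subtype.ext_iff]
  constructor
  · rw [Nat.card_eq_fintype_card (α := {q // IsAdmissible hk q}), ← card_of_dual_of_closure_eq_top _
      (fun q : {q // IsAdmissible hk q} => F q.1) hF' (h.closure_blockMonomial_eq_top htop),
      ← hj.range_eq]
    exact (Nat.card_congr (Equiv.ofInjective j hj.injective)).symm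
  · intro p hp hp1
    rw [← hj.range_eq] at hp
    obtain ⟨m, rfl⟩ := hp
    have hm := eq_sum_of_dual_of_closure_eq_top _
      (fun q : {q // IsAdmissible hk q} => F q.1) hF' (h.closure_blockMonomial_eq_top htop) m.toAdd
    rw [Finset.sum_eq_zero fun q _ => by rw [hF0 m.toAdd hp1 q.1, zero_smul]] at hm
    have : m = 1 := hm
    rw [this, map_one]

/-- The number of admissible pairs. -/
theorem card_isAdmissible {n : ℕ} {k : Fin n → ℕ} (hk : ∀ i, 0 < k i) :
    Nat.card {q // IsAdmissible hk q} + 2 ^ n = (∑ i, k i) * 2 ^ (n - 1) + 1 := by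
  classical
  rw [Nat.card_eq_fintype_card, Fintype.card_subtype]
  have h1 : (Finset.univ.filter fun q : BlockIndex k × Finset (Fin n) => q.1.1 ∉ q.2).card =
      (∑ i, k i) * 2 ^ (n - 1) := by
    rw [Finset.card_filter, Fintype.sum_prod_type]
    have : ∀ x : BlockIndex k, (∑ A : Finset (Fin n), if x.1 ∉ A then 1 else 0) = 2 ^ (n - 1) := by
      intro x
      rw [← Finset.card_filter]
      have : (Finset.univ.filter fun A : Finset (Fin n) => x.1 ∉ A) =
          (Finset.univ.erase x.1).powerset := by
        ext A
        simp [Finset.subset_erase]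
      rw [this, Finset.card_powerset, Finset.card_erase_of_mem (Finset.mem_univ _),
        Finset.card_univ, Fintype.card_fin]
    rw [Finset.sum_congr rfl fun x _ => this x, Finset.sum_const, Finset.card_univ,
      Fintype.card_sigma, smul_eq_mul]
    simp
  -- The excluded pairs are (h_i, A) with all of A below i. They correspond to the nonempty sets A ∪
  -- {i}, from which i is recovered as the maximum, so there are 2^n - 1 of them.
  have h2 : ((Finset.univ.filter fun q : BlockIndex k × Finset (Fin n) => q.1.1 ∉ q.2).filter
      fun q => q.1 = blockBase hk q.1.1 ∧ ∀ l ∈ q.2, l < q.1.1).card + 1 = 2 ^ n := by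
    have : (Finset.univ.erase (∅ : Finset (Fin n))).card + 1 = 2 ^ n := by
      rw [Finset.card_erase_add_one (Finset.mem_univ _), Finset.card_univ, Fintype.card_finset,
        Fintype.card_fin]
    rw [← this]
    congr 1
    refine Finset.card_bij (fun q _ => insert q.1.1 q.2) ?_ ?_ ?_
    · intro q _
      simp
    · rintro ⟨x, A⟩ hq ⟨y, B⟩ hq' he
      simp only [Finset.mem_filter, Finset.mem_univ, true_and] at hq hq' he
      obtain ⟨hxA, hx, hA⟩ := hq
      obtain ⟨hyB, hy, hB⟩ := hq'
      have hxy : x.1 = y.1 := by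
        apply le_antisymm
        · rcases Finset.mem_insert.1 (he ▸ Finset.mem_insert_self x.1 A) with e | e
          · exact e.le
          · exact (hB _ e).le
        · rcases Finset.mem_insert.1 (he.symm ▸ Finset.mem_insert_self y.1 B) with e | e
          · exact e.le
          · exact (hA _ e).le
      have hAB : A = B := by
        rw [← Finset.erase_insert hxA, he, hxy, Finset.erase_insert hyB]
      rw [hx, hy, hxy, hAB]
    · intro B hB
      have hne : B.Nonempty := Finset.nonempty_iff_ne_empty.2 (Finset.ne_of_mem_erase hB)
      refine ⟨(blockBase hk (B.max' hne), B.erase (B.max' hne)), ?_, ?_⟩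
      · rw [Finset.mem_filter, Finset.mem_filter]
        exact ⟨⟨Finset.mem_univ _, Finset.notMem_erase _ _⟩, rfl, fun l hl =>
          lt_of_le_of_ne (B.le_max' l (Finset.mem_of_mem_erase hl)) (Finset.ne_of_mem_erase hl)⟩
      · exact Finset.insert_erase (B.max'_mem hne)
  have h3 := Finset.card_filter_add_card_filter_not (s := Finset.univ.filter
    fun q : BlockIndex k × Finset (Fin n) => q.1.1 ∉ q.2)
    (fun q => q.1 = blockBase hk q.1.1 ∧ ∀ l ∈ q.2, l < q.1.1)
  have h4 : (Finset.univ.filter fun q => IsAdmissible hk q) =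
      (Finset.univ.filter fun q : BlockIndex k × Finset (Fin n) => q.1.1 ∉ q.2).filter
        fun q => ¬(q.1 = blockBase hk q.1.1 ∧ ∀ l ∈ q.2, l < q.1.1) := by
    rw [Finset.filter_filter]
    exact Finset.filter_congr fun _ _ => Iff.rfl
  rw [h4]
  omega

/-! ### Expansion groups are generated by their distinguished generators -/

/-- In characteristic 2 squaring is additive, and every element of V_T squares to 1. -/
theorem groupAlg_mul_self {T : Type*} (r : MonoidAlgebra (ZMod 2) (VSpace T)) :
    r * r = augmentation T r • (1 : MonoidAlgebra (ZMod 2) (VSpace T)) := by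
  induction r using MonoidAlgebra.induction_on with
  | of v =>
    have : augmentation T (MonoidAlgebra.of (ZMod 2) (VSpace T) v) = 1 := by simp [augmentation]
    rw [this, ← map_mul, vspace_mul_self, map_one, one_smul]
  | add a b ha hb =>
    rw [map_add, add_smul, ← ha, ← hb]
    calc (a + b) * (a + b) = a * a + b * b + (a * b + a * b) := by ring
      _ = _ := by rw [groupAlg_add_self, add_zero]
  | smul c a ha =>
    have hc : c = 0 ∨ c = 1 := by revert c; decide
    rcases hc with rfl | rfl
    · simp
    · rw [one_smul, ha]

/-- Elements of augmentation 0 have square 0, and the nilradical of a finite ring is nilpotent. -/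
theorem isNilpotent_ker_augmentation (T : Type*) [Finite T] :
    IsNilpotent (RingHom.ker (augmentation T)) := by
  have : IsArtinianRing (MonoidAlgebra (ZMod 2) (VSpace T)) := IsArtinianRing.of_finite (ZMod 2) _
  obtain ⟨m, hm⟩ := IsArtinianRing.isNilpotent_nilradical
    (R := MonoidAlgebra (ZMod 2) (VSpace T))
  refine ⟨m, le_bot_iff.1 (le_trans (Ideal.pow_right_mono (fun r hr => ?_) m) hm.le)⟩
  refine ⟨2, ?_⟩
  rw [pow_two, groupAlg_mul_self, (RingHom.mem_ker).1 hr, zero_smul]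
  exact Submodule.zero_mem _

/-- Nakayama for a nilpotent ideal, by iterating M = N + JM. No finiteness of M is needed, which
matters because expansion groups are not assumed finite. -/
theorem eq_top_of_sup_smul_top_eq_top {R M : Type*} [CommRing R] [AddCommGroup M] [Module R M]
    {J : Ideal R} (hJ : IsNilpotent J) {N : Submodule R M}
    (h : N ⊔ J • (⊤ : Submodule R M) = ⊤) : N = ⊤ := by
  have key : ∀ m : ℕ, N ⊔ J ^ m • (⊤ : Submodule R M) = ⊤ := by
    intro m
    induction m with
    | zero => rw [pow_zero, Ideal.one_eq_top, Submodule.top_smul, sup_top_eq]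
    | succ m ih =>
      rw [eq_top_iff]
      conv_lhs => rw [← ih]
      refine sup_le le_sup_left ?_
      conv_lhs => rw [← h]
      rw [Submodule.smul_sup, ← Submodule.mul_smul, ← pow_succ]
      exact sup_le_sup_right Submodule.smul_le_right _
  obtain ⟨m, hm⟩ := hJ
  have := key m
  rwa [hm, Ideal.zero_eq_bot, Submodule.bot_smul, sup_bot_eq] at this

theorem blockSum_basisVec {n : ℕ} {k : Fin n → ℕ} (x : BlockIndex k) :
    blockSum k (basisVec x) = basisVec x.1 := by
  apply Multiplicative.toAdd.injective
  ext l
  obtain ⟨i, a⟩ := x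
  change ∑ b : Fin (k l), (Pi.single (⟨i, a⟩ : BlockIndex k) 1 : BlockIndex k → ZMod 2) ⟨l, b⟩ =
    (Pi.single i 1 : Fin n → ZMod 2) l
  rcases eq_or_ne l i with rfl | hl
  · simp [Pi.single_apply]
  · simp [hl]

theorem range_eq_top_of_basisVec {T Γ : Type*} [Fintype T] [DecidableEq T] [Group Γ]
    {φ : Γ →* VSpace T} (h : ∀ t, basisVec t ∈ φ.range) : φ.range = ⊤ := by
  rw [eq_top_iff, ← vspace_closure_basisVec, Subgroup.closure_le]
  rintro _ ⟨t, rfl⟩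
  exact h t

namespace IsBlockExpansionGroup

variable {n : ℕ} {k : Fin n → ℕ} {Γ : Type*} [Group Γ] {φ : Γ →* VSpace (BlockIndex k)}
  {g : BlockIndex k → Γ}

theorem blockSum_map_gen (h : IsBlockExpansionGroup k φ g) (x : BlockIndex k) :
    (blockSum k).comp φ (g x) = basisVec x.1 := by
  rw [MonoidHom.comp_apply, h.isExpansionGroup.map_gen, blockSum_basisVec]

theorem surjective (h : IsBlockExpansionGroup k φ g) (hk : ∀ i, 0 < k i) :
    Function.Surjective ((blockSum k).comp φ) :=
  MonoidHom.range_eq_top.1 (range_eq_top_of_basisVec fun i =>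
    ⟨g (blockBase hk i), h.blockSum_map_gen _⟩)

open scoped commutatorElement in
-- Let H be generated by the g_x, let N be the part of the kernel M of ψ lying in H, and let J be
-- the augmentation ideal. Modulo N + JM the group is abelian, so ker φ = [Γ, Γ] lies in N + JM.
-- Since H surjects onto V, this gives M = N + JM, and Nakayama gives N = M.
theorem closure_gen_eq_top (h : IsBlockExpansionGroup k φ g) (hk : ∀ i, 0 < k i) :
    Subgroup.closure (Set.range g) = ⊤ := by
  set H := Subgroup.closure (Set.range g) with hH
  set ψ := (blockSum k).comp φ with hψ
  obtain ⟨M, _, _, j, hj⟩ := exists_isKernelModule ψ (h.surjective hk) h.ker_block_vectorSpace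
  have hφH : ∀ p, ∃ q ∈ H, φ q = φ p := by
    intro p
    have : (φ.comp H.subtype).range = ⊤ := range_eq_top_of_basisVec fun x =>
      ⟨⟨g x, Subgroup.subset_closure ⟨x, rfl⟩⟩, h.isExpansionGroup.map_gen x⟩
    obtain ⟨q, hq⟩ := MonoidHom.range_eq_top.1 this (φ p)
    exact ⟨q, q.2, hq⟩
  have hφψ : φ.ker ≤ ψ.ker := fun p hp => by
    rw [MonoidHom.mem_ker, hψ, MonoidHom.comp_apply, MonoidHom.mem_ker.1 hp, map_one]
  have hmem : ∀ p, p ∈ ψ.ker → ∃ m, j (.ofAdd m) = p := fun p hp => by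
    rw [← hj.range_eq] at hp
    obtain ⟨m, rfl⟩ := hp
    exact ⟨m.toAdd, rfl⟩
  let N₀ : AddSubgroup M := Subgroup.toAddSubgroup' (H.comap j)
  have hN₀ : ∀ m, m ∈ N₀ ↔ j (.ofAdd m) ∈ H := fun m => Iff.rfl
  -- Stability under the group algebra uses that `H` already surjects onto V, so the action of every
  -- group element is conjugation by an element of `H`.
  let N : Submodule (MonoidAlgebra (ZMod 2) (VSpace (Fin n))) M :=
    { N₀ with
      smul_mem' := fun r m hm => smul_mem_of_forall_of_smul_mem N₀ m (fun v => by
        obtain ⟨p, rfl⟩ := h.surjective hk v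
        obtain ⟨q, hq, hqp⟩ := hφH p
        have h1 := hj.conj q m
        rw [← mul_inv_eq_iff_eq_mul] at h1
        rw [MonoidHom.comp_apply, ← hqp, hN₀]
        change j (.ofAdd (MonoidAlgebra.of (ZMod 2) (VSpace (Fin n)) (ψ q) • m)) ∈ H
        rw [← h1]
        exact mul_mem (mul_mem hq hm) (inv_mem hq)) r }
  have hN : ∀ m, m ∈ N ↔ j (.ofAdd m) ∈ H := fun m => Iff.rfl
  set J := RingHom.ker (augmentation (Fin n)) with hJ
  let D : Subgroup Γ := (AddSubgroup.toSubgroup (N ⊔ J • ⊤).toAddSubgroup).map j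
  have hD : ∀ m ∈ N ⊔ J • ⊤, j (.ofAdd m) ∈ D := fun m hm => ⟨.ofAdd m, hm, rfl⟩
  have hnormal : D.Normal := ⟨by
    rintro _ ⟨m, hm, rfl⟩ p
    have := hj.conj p m.toAdd
    rw [ofAdd_toAdd, ← mul_inv_eq_iff_eq_mul] at this
    rw [this]
    exact hD _ ((N ⊔ J • ⊤).smul_mem _ hm)⟩
  have hHH : ∀ p ∈ H, ∀ q ∈ H, Commute (QuotientGroup.mk' D p) (QuotientGroup.mk' D q) := by
    intro p hp q hq
    rw [← commutatorElement_eq_one_iff_commute, ← map_commutatorElement, QuotientGroup.mk'_apply,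
      QuotientGroup.eq_one_iff]
    obtain ⟨m, hm⟩ := hmem ⁅p, q⁆ (by
      rw [MonoidHom.mem_ker, map_commutatorElement, commutatorElement_eq_one_iff_mul_comm, mul_comm])
    rw [← hm]
    refine hD _ (Submodule.mem_sup_left ?_)
    rw [hN, hm, commutatorElement_def]
    exact mul_mem (mul_mem (mul_mem hp hq) (inv_mem hp)) (inv_mem hq)
  -- An element of V_{[n]} changes m by a multiple from the augmentation ideal, so the kernel
  -- becomes central modulo `D`.
  have hcent : ∀ p m, Commute (QuotientGroup.mk' D p) (QuotientGroup.mk' D (j (.ofAdd m))) := by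
    intro p m
    have h1 : MonoidAlgebra.of (ZMod 2) (VSpace (Fin n)) (ψ p) • m =
        (MonoidAlgebra.of (ZMod 2) (VSpace (Fin n)) (ψ p) - 1) • m + m := by
      rw [sub_smul, one_smul, sub_add_cancel]
    have h2 : (MonoidAlgebra.of (ZMod 2) (VSpace (Fin n)) (ψ p) - 1) • m ∈ N ⊔ J • ⊤ := by
      refine Submodule.mem_sup_right (Submodule.smul_mem_smul ?_ trivial)
      rw [hJ, RingHom.mem_ker, map_sub, map_one]
      simp [augmentation]
    change _ * _ = _ * _
    rw [← map_mul, hj.conj, map_mul, h1, ofAdd_add, map_mul, map_mul,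
      QuotientGroup.mk'_apply D (j (.ofAdd (_ • m))), (QuotientGroup.eq_one_iff _).2 (hD _ h2),
      one_mul]
  have hfac : ∀ p, ∃ q ∈ H, ∃ m, p = q * j (.ofAdd m) ∧ φ (j (.ofAdd m)) = 1 := by
    intro p
    obtain ⟨q, hq, hqp⟩ := hφH p
    have h1 : φ (q⁻¹ * p) = 1 := by rw [map_mul, map_inv, hqp, inv_mul_cancel]
    obtain ⟨m, hm⟩ := hmem (q⁻¹ * p) (hφψ h1)
    exact ⟨q, hq, m, by rw [hm, mul_inv_cancel_left], by rw [hm, h1]⟩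
  have hcomm : commutator Γ ≤ D := by
    rw [commutator_def, Subgroup.commutator_le]
    intro p _ q _
    obtain ⟨p', hp', a, rfl, -⟩ := hfac p
    obtain ⟨q', hq', b, rfl, -⟩ := hfac q
    rw [← QuotientGroup.eq_one_iff, ← QuotientGroup.mk'_apply, map_commutatorElement,
      commutatorElement_eq_one_iff_commute, map_mul, map_mul]
    exact Commute.mul_left ((hHH p' hp' q' hq').mul_right (hcent p' b))
      (Commute.mul_right (hcent q' a).symm (hcent _ b))
  have htop : N ⊔ J • ⊤ = ⊤ := by
    rw [eq_top_iff]
    intro m _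
    obtain ⟨q, hq, b, hqb, hb⟩ := hfac (j (.ofAdd m))
    have hbD : j (.ofAdd b) ∈ D := hcomm (by rw [h.isExpansionGroup.commutator_eq]; exact hb)
    obtain ⟨b', hb', he⟩ := hbD
    rw [hj.injective he] at hb'
    have h1 : m = (m - b) + b := (sub_add_cancel m b).symm
    rw [h1]
    refine add_mem (Submodule.mem_sup_left ?_) hb'
    rw [hN, ofAdd_sub, map_div, hqb, mul_div_cancel_right]
    exact hq
  have hNtop := eq_top_of_sup_smul_top_eq_top (isNilpotent_ker_augmentation (Fin n)) htop
  rw [eq_top_iff]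
  intro p _
  obtain ⟨q, hq, m, rfl, -⟩ := hfac p
  exact mul_mem hq ((hN m).1 (by rw [hNtop]; trivial))

end IsBlockExpansionGroup

/-! ### The governing group is a block expansion group -/

theorem closure_range_mk_eq_top {ι Γ : Type*} [Group Γ] (v : ι → Γ) :
    Subgroup.closure (Set.range fun i =>
      (⟨v i, Subgroup.subset_closure ⟨i, rfl⟩⟩ : Subgroup.closure (Set.range v))) = ⊤ := by
  rw [← Subgroup.closure_closure_coe_preimage (k := Set.range v)]
  congr 1
  ext ⟨p, hp⟩
  simp

theorem closure_governingBlockGen {n : ℕ} (k : Fin n → ℕ) :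
    Subgroup.closure (Set.range (governingBlockGen k)) = ⊤ := by
  have h : Subgroup.closure (Set.range (governingGen (S := BlockIndex k))) = ⊤ :=
    closure_range_mk_eq_top _
  have hr : Set.range (governingBlockGen k) =
      QuotientGroup.mk' (governingKernel k) '' Set.range governingGen := by
    rw [← Set.range_comp]
    rfl
  rw [hr, ← MonoidHom.map_closure, h, Subgroup.map_top_of_surjective _
    (QuotientGroup.mk'_surjective _)]

theorem governingGen_sq {S : Type*} [DecidableEq S] (s : S) : governingGen s ^ 2 = 1 := by
  apply Subtype.ext
  funext t
  change singleGen t s ^ 2 = 1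
  unfold singleGen
  split_ifs
  · rw [pow_two, pointerElt_mul_self]
  · rw [pow_two, transElt_mul_self]

theorem governingBlockProj_gen {n : ℕ} (k : Fin n → ℕ) (x : BlockIndex k) :
    governingBlockProj k (governingBlockGen k x) = basisVec x :=
  governingProj_governingGen x

theorem governingBlockGen_sq {n : ℕ} (k : Fin n → ℕ) (x : BlockIndex k) :
    governingBlockGen k x ^ 2 = 1 := by
  unfold governingBlockGen
  rw [← QuotientGroup.mk_pow, governingGen_sq, QuotientGroup.mk_one]

/-- On the preimage of the kernel of the block sums, `φ_x` takes values in the group algebra. -/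
theorem exists_blockHom_eq_inl {n : ℕ} (k : Fin n → ℕ) (x : BlockIndex k)
    (z : governingSubgroup (BlockIndex k))
    (hz : blockSum k (governingProj (BlockIndex k) z) = 1) :
    ∃ a, blockHom k x z = SemidirectProduct.inl (.ofAdd a) := by
  refine ⟨(blockHom k x z).left.toAdd, SemidirectProduct.ext rfl ?_⟩
  rw [SemidirectProduct.right_inl]
  change blockSumAway k x (z.1 x).right = 1
  apply Multiplicative.toAdd.injective
  ext l
  have h1 := congrFun (congrArg Multiplicative.toAdd hz) l.1
  rw [governingProj_eq x] at h1
  refine Eq.trans ?_ h1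
  change ∑ a : Fin (k l.1), _ = ∑ a : Fin (k l.1), _
  refine Finset.sum_congr rfl fun a _ => ?_
  have hne : (⟨l.1, a⟩ : BlockIndex k) ≠ x := fun e => l.2 (congrArg Sigma.fst e)
  have h2 : (singleProj x (z.1 x)).toAdd ⟨l.1, a⟩ = (z.1 x).right.toAdd ⟨⟨l.1, a⟩, hne⟩ :=
    dif_neg hne
  exact h2.symm

/-- The quotient is by the intersection of the kernels of the φ_x, so relations may be checked after
applying each φ_x. Over the kernel of the block sums these take values in the group algebra, which
is commutative of exponent 2. -/
theorem isBlockExpansionGroup_governing {n : ℕ} (k : Fin n → ℕ) :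
    IsBlockExpansionGroup k (governingBlockProj k) (governingBlockGen k) := by
  have hK : IsF2VectorSpace ((blockSum k).ker.comap (governingBlockProj k)) := by
    constructor
    · intro a ha b hb
      obtain ⟨y, rfl⟩ := QuotientGroup.mk_surjective a
      obtain ⟨z, rfl⟩ := QuotientGroup.mk_surjective b
      rw [← QuotientGroup.mk_mul, ← QuotientGroup.mk_mul, QuotientGroup.eq]
      refine Subgroup.mem_iInf.2 fun x => ?_
      obtain ⟨r, hr⟩ := exists_blockHom_eq_inl k x y ha
      obtain ⟨s, hs⟩ := exists_blockHom_eq_inl k x z hb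
      rw [MonoidHom.mem_ker, map_mul, map_inv, map_mul, map_mul, hr, hs,
        ← map_mul SemidirectProduct.inl, ← map_mul SemidirectProduct.inl,
        mul_comm (Multiplicative.ofAdd r), inv_mul_cancel]
    · intro a ha
      obtain ⟨y, rfl⟩ := QuotientGroup.mk_surjective a
      rw [← QuotientGroup.mk_pow, QuotientGroup.eq_one_iff]
      refine Subgroup.mem_iInf.2 fun x => ?_
      obtain ⟨r, hr⟩ := exists_blockHom_eq_inl k x y ha
      rw [MonoidHom.mem_ker, map_pow, hr, pow_two, ← map_mul, ← ofAdd_add, groupAlg_add_self,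
        ofAdd_zero, map_one]
  have hle : (governingBlockProj k).ker ≤ (blockSum k).ker.comap (governingBlockProj k) :=
    fun p hp => by
      rw [Subgroup.mem_comap, MonoidHom.mem_ker.1 hp]
      exact one_mem _
  exact ⟨⟨governingBlockProj_gen k, ⟨fun a ha b hb => hK.1 a (hle ha) b (hle hb),
    fun a ha => hK.2 a (hle ha)⟩, commutator_eq_ker_of_closure_eq_top (governingBlockProj_gen k)
      (governingBlockGen_sq k) (closure_governingBlockGen k), governingBlockGen_sq k⟩, hK⟩

/-- Extension by zero `V_{T - {i}} → V_T`. -/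
def extendByZero {T : Type*} [DecidableEq T] (i : T) : VSpace {h : T // h ≠ i} →* VSpace T :=
  AddMonoidHom.toMultiplicative
    { toFun := fun v l => if h : l = i then 0 else v ⟨l, h⟩
      map_zero' := funext fun l => by by_cases h : l = i <;> simp [h]
      map_add' := fun v w => funext fun l => by by_cases h : l = i <;> simp [h] }

theorem extendByZero_basisVec {T : Type*} [DecidableEq T] {i t : T} (h : t ≠ i) :
    extendByZero i (basisVec ⟨t, h⟩) = basisVec t := by
  apply Multiplicative.toAdd.injective
  funext l
  change (if h' : l = i then (0 : ZMod 2) else (Pi.single (⟨t, h⟩ : {h : T // h ≠ i}) (1 : ZMod 2) :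
    {h : T // h ≠ i} → ZMod 2) ⟨l, h'⟩) = (Pi.single t 1 : T → ZMod 2) l
  split_ifs with h'
  · rw [Pi.single_eq_of_ne (fun e => h (e.symm.trans h'))]
  · simp [Pi.single_apply, Subtype.ext_iff]

/-- The homomorphism induced by `φ_x` on the governing group. -/
noncomputable def governingPointer {n : ℕ} (k : Fin n → ℕ) (x : BlockIndex k) :
    GoverningBlockGroup k →* GroupAlgSemidirect (Fin n) :=
  (GroupAlgSemidirect.map (extendByZero x.1)).comp
    (QuotientGroup.lift _ (blockHom k x) (iInf_le (fun x => (blockHom k x).ker) x))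

theorem isPointerFamily_governing {n : ℕ} (k : Fin n → ℕ) :
    IsPointerFamily (governingBlockGen k) (governingPointer k) := by
  intro x y
  change GroupAlgSemidirect.map (extendByZero x.1) (blockHom k x (governingGen y)) = _
  rw [blockHom_governingGen]
  split_ifs with h h'
  · simp [pointerElt, GroupAlgSemidirect.map]
  · rw [map_one]
  · rw [transElt, transElt, ← extendByZero_basisVec h]
    simp [GroupAlgSemidirect.map]

/-! ### Universality -/

/-- A block expansion group generated by its distinguished generators and mapping to the
governing group maps isomorphically to it. -/
theorem bijective_of_isExpansionHom_governing {n : ℕ} {k : Fin n → ℕ} (hk : ∀ i, 0 < k i)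
    {Γ : Type*} [Group Γ] {φ : Γ →* VSpace (BlockIndex k)} {g : BlockIndex k → Γ}
    (h : IsBlockExpansionGroup k φ g) (f : Γ →* GoverningBlockGroup k)
    (hf : IsExpansionHom g (governingBlockGen k) f) : Function.Bijective f := by
  have htop := h.closure_gen_eq_top hk
  have hφ : (governingBlockProj k).comp f = φ := by
    refine MonoidHom.eq_of_eqOn_dense htop ?_
    rintro _ ⟨x, rfl⟩
    rw [MonoidHom.comp_apply, hf, governingBlockProj_gen, h.isExpansionGroup.map_gen]
  -- The pointers of the governing group pull back along `f`. An element killed by `f` lies in the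
  -- kernel of the block sums and is killed by all pulled-back pointers, hence is trivial.
  have hχ : IsPointerFamily g fun x => (governingPointer k x).comp f := fun x y => by
    change governingPointer k x (f (g y)) = _
    rw [hf, isPointerFamily_governing]
  constructor
  · rw [injective_iff_map_eq_one]
    intro p hp
    refine (card_ker_and_eq_one_of_pointer hk (h.surjective hk) h.ker_block_vectorSpace
      h.blockSum_map_gen h.isExpansionGroup.gen_sq htop hχ).2 p ?_ fun x => ?_
    · rw [MonoidHom.mem_ker, ← hφ, MonoidHom.comp_apply, MonoidHom.comp_apply, hp, map_one, map_one]
    · rw [MonoidHom.comp_apply, hp, map_one]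
  · rw [← MonoidHom.range_eq_top, eq_top_iff, ← closure_governingBlockGen, Subgroup.closure_le]
    rintro _ ⟨x, rfl⟩
    exact ⟨g x, hf x⟩

/-- Every block expansion group receives a homomorphism from the governing group. -/
theorem exists_isExpansionHom_of_governing {n : ℕ} {k : Fin n → ℕ} (hk : ∀ i, 0 < k i)
    {Γ : Type*} [Group Γ] {φ : Γ →* VSpace (BlockIndex k)} {g : BlockIndex k → Γ}
    (h : IsBlockExpansionGroup k φ g) :
    ∃ f : GoverningBlockGroup k →* Γ, IsExpansionHom (governingBlockGen k) g f := by
  have hG := isBlockExpansionGroup_governing k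
  let v : BlockIndex k → Γ × GoverningBlockGroup k := fun x => (g x, governingBlockGen k x)
  let P := Subgroup.closure (Set.range v)
  let gP : BlockIndex k → P := fun x => ⟨v x, Subgroup.subset_closure ⟨x, rfl⟩⟩
  have htop : Subgroup.closure (Set.range gP) = ⊤ := closure_range_mk_eq_top v
  let p₁ : P →* Γ := (MonoidHom.fst _ _).comp P.subtype
  let p₂ : P →* GoverningBlockGroup k := (MonoidHom.snd _ _).comp P.subtype
  have hφ : φ.comp p₁ = (governingBlockProj k).comp p₂ := by
    refine MonoidHom.eq_of_eqOn_dense htop ?_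
    rintro _ ⟨x, rfl⟩
    exact (h.isExpansionGroup.map_gen x).trans (governingBlockProj_gen k x).symm
  -- Used for `W = ⊥` and for the kernel of the block sums: being an 𝔽₂-vector space is checked on
  -- the two components of P.
  have hpair : ∀ W : Subgroup (VSpace (BlockIndex k)), IsF2VectorSpace (W.comap φ) →
      IsF2VectorSpace (W.comap (governingBlockProj k)) →
      IsF2VectorSpace (W.comap (φ.comp p₁)) := by
    intro W h₁ h₂
    have hmem : ∀ a ∈ W.comap (φ.comp p₁), p₂ a ∈ W.comap (governingBlockProj k) :=
      fun a ha => by rw [hφ] at ha; exact ha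
    constructor
    · intro a ha b hb
      exact Subtype.ext (Prod.ext (h₁.1 _ ha _ hb) (h₂.1 _ (hmem a ha) _ (hmem b hb)))
    · intro a ha
      exact Subtype.ext (Prod.ext (h₁.2 _ ha) (h₂.2 _ (hmem a ha)))
  have hgen : ∀ x, φ.comp p₁ (gP x) = basisVec x := h.isExpansionGroup.map_gen
  have hsq : ∀ x, gP x ^ 2 = 1 := fun x =>
    Subtype.ext (Prod.ext (h.isExpansionGroup.gen_sq x) (governingBlockGen_sq k x))
  have hP : IsBlockExpansionGroup k (φ.comp p₁) gP :=
    ⟨⟨hgen, hpair ⊥ h.isExpansionGroup.ker_vectorSpace hG.isExpansionGroup.ker_vectorSpace,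
      commutator_eq_ker_of_closure_eq_top hgen hsq htop, hsq⟩,
      hpair _ h.ker_block_vectorSpace hG.ker_block_vectorSpace⟩
  let e := MulEquiv.ofBijective p₂
    (bijective_of_isExpansionHom_governing hk hP p₂ fun x => rfl)
  refine ⟨p₁.comp e.symm.toMonoidHom, fun x => ?_⟩
  have : e.symm (governingBlockGen k x) = gP x := by
    rw [MulEquiv.symm_apply_eq]
    rfl
  change p₁ (e.symm (governingBlockGen k x)) = g x
  rw [this]
  rfl

/-! ### Order of the governing group and conclusion -/

theorem card_governingBlockGroup {n : ℕ} {k : Fin n → ℕ} (hk : ∀ i, 0 < k i) :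
    Nat.card (GoverningBlockGroup k) = 2 ^ ((∑ i, k i) * 2 ^ (n - 1) + n + 1 - 2 ^ n) := by
  have h := isBlockExpansionGroup_governing k
  have h1 := (card_ker_and_eq_one_of_pointer hk (h.surjective hk) h.ker_block_vectorSpace
    h.blockSum_map_gen h.isExpansionGroup.gen_sq (closure_governingBlockGen k)
    (isPointerFamily_governing k)).1
  rw [Subgroup.card_eq_card_quotient_mul_card_subgroup ((blockSum k).comp (governingBlockProj k)).ker,
    h1, Nat.card_congr (QuotientGroup.quotientKerEquivOfSurjective _ (h.surjective hk)).toEquiv]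
  have h2 : Nat.card (VSpace (Fin n)) = 2 ^ n := by
    rw [Nat.card_congr Multiplicative.toAdd, Nat.card_eq_fintype_card, Fintype.card_fun, ZMod.card,
      Fintype.card_fin]
  rw [h2, ← pow_add]
  congr 1
  -- This identity shows that the natural-number subtraction of 2^n in the exponent does not
  -- truncate.
  have := card_isAdmissible hk
  omega

theorem mainTheorem8 (n : ℕ) (hn : 0 < n) (k : Fin n → ℕ) (hk : ∀ i, 0 < k i) :
    IsBlockExpansionGroup k (governingBlockProj k) (governingBlockGen k) ∧
    ∀ (G : Type*) [Group G] (φ : G →* VSpace (BlockIndex k)) (g : BlockIndex k → G),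
      IsBlockExpansionGroup k φ g →
      ∃ f : GoverningBlockGroup k →* G,
        (IsExpansionHom (governingBlockGen k) g f ∧ Function.Surjective f) ∧
        (∀ f' : GoverningBlockGroup k →* G,
          IsExpansionHom (governingBlockGen k) g f' → f' = f) ∧
        Finite G ∧
        Nat.card G ≤ 2 ^ ((∑ i, k i) * 2 ^ (n - 1) + n + 1 - 2 ^ n) ∧
        (Nat.card G = 2 ^ ((∑ i, k i) * 2 ^ (n - 1) + n + 1 - 2 ^ n) ↔
          Function.Bijective f) := by
  refine ⟨isBlockExpansionGroup_governing k, fun G _ φ g h => ?_⟩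
  obtain ⟨f, hf⟩ := exists_isExpansionHom_of_governing hk h
  have hsurj : Function.Surjective f := by
    rw [← MonoidHom.range_eq_top, eq_top_iff, ← h.closure_gen_eq_top hk, Subgroup.closure_le]
    rintro _ ⟨x, rfl⟩
    exact ⟨_, hf x⟩
  have hcard := card_governingBlockGroup hk
  have hfin : Finite (GoverningBlockGroup k) :=
    Nat.finite_of_card_ne_zero (by rw [hcard]; positivity)
  refine ⟨f, ⟨hf, hsurj⟩, fun f' hf' => ?_, Finite.of_surjective f hsurj, ?_, ?_⟩
  · refine MonoidHom.eq_of_eqOn_dense (closure_governingBlockGen k) ?_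
    rintro _ ⟨x, rfl⟩
    rw [hf, hf']
  · rw [← hcard]
    exact Nat.card_le_card_of_surjective f hsurj
  · rw [← hcard]
    exact ⟨fun e => hsurj.bijective_of_nat_card_le e.ge,
      fun hb => (Nat.card_congr (Equiv.ofBijective f hb)).symm⟩
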